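/- Let $K:\mathbb{R}\to\mathbb{R}$ belong to $L^1(\mathbb{R})\cap L^2(\mathbb{R})$ and not vanish almost everywhere, let $h>0$, and put $K_h(t)=\frac1h K(t/h)$. Let $X=(X^1,X^2)$ be a random vector in $\mathbb{R}^2$ with a square integrable density $f$, and let $X_1,\dots,X_N$, $X_i=(X_i^1,X_i^2)$, $N\ge 2$, be an i.i.d. sample of $X$. Put $$f_h(x_1,x_2)=\int_{\mathbb{R}^2} f(u,v)K_h(x_1-u)K_h(x_2-v)\,du\,dv,\qquad \hat f_h(x_1,x_2)=\frac1N\sum_{i=1}^N K_h(x_1-X_i^1)K_h(x_2-X_i^2),$$ and let $T_h,\hat T_h:L^2(\mathbb{R})\to L^2(\mathbb{R})$ be the integral operators $$[T_h w](x_2)=\int_{\mathbb{R}} w(x_1)f_h(x_1,x_2)\,dx_1,\qquad [\hat T_h w](x_2)=\int_{\mathbb{R}} w(x_1)\hat f_h(x_1,x_2)\,dx_1 .$$ For $x=(x_1,x_2)\in\mathbb{R}^2$ let $T_{h,x}=K_h(x_2-\cdot)\otimes K_h(x_1-\cdot)$ be the rank-one operator $w\mapsto \langle K_h(x_1-\cdot),w\rangle\,K_h(x_2-\cdot)$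 on $L^2(\mathbb{R})$. Let $\|\cdot\|_{HS}$ be the Hilbert-Schmidt norm, and put $$L_h=\sup_{x,x'\in\mathbb{R}^2}\|T_{h,x}-T_{h,x'}\|_{HS},\qquad \sigma_h^2=E\|T_{h,X}-T_h\|_{HS}^2 .$$ Then all these objects are well defined, $0<L_h<\infty$, $0<\sigma_h^2<\infty$, and the following hold. (i) For all $\tau>0$, $$P\big(\|\hat T_h-T_h\|_{HS}>\tau\big)\le 2\exp\Big\{-\frac{\tau N}{L_h}\ln\Big(1+\frac{\tau L_h}{\sigma_h^2}\Big)\Big\}\Big(1+\frac{\tau}{L_h}-\frac{\sigma_h^2}{L_h^2}\ln\Big(1+\frac{\tau L_h}{\sigma_h^2}\Big)\Big)^N .$$ (ii) For every $0<\delta<1$ there is a $\tau>0$ for which the right-hand side of (i) is equal to $\delta$, and for every such value $\tau=\tau_h(N,\delta)$ the inequality $\|\hat T_h-T_h\|_{HS}\le\tau_h(N,\delta)$ holds with probability at least $1-\delta$. (iii) For every $0<\delta<1/2$, with probability greater than $1-2\delta$, $$\|\hat T_h-T_h\|_{HS}\le \hat\tau_h(N,\delta):=\frac{2L_h\ln(2/\delta)}{N}+\sqrt{\frac{\ln(2/\delta)}{N}\Big(\frac{1}{N(N-1)}\sum_{i\ne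 j}\|T_{h,X_i}-T_{h,X_j}\|_{HS}^2+L_h^2\sqrt{\frac{\ln(1/\delta)}{N}}\Big)} .$$ -/

import Mathlib

open MeasureTheory ProbabilityTheory
open scoped ENNReal

noncomputable section

namespace MixtureRank

section HilbertSchmidt

/-- The double sum `∑ᵢ ∑ⱼ ⟨eⱼ, A eᵢ⟩²` over an orthonormal basis, with values in `[0, ∞]`. -/
def hsSum {H : Type*} [NormedAddCommGroup H] [InnerProductSpace ℝ H]
    {ι : Type*} (e : HilbertBasis ι ℝ H) (A : H →L[ℝ] H) : ℝ≥0∞ :=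
  ∑' i, ∑' j, ENNReal.ofReal ((inner ℝ (e j) (A (e i))) ^ 2)

theorem tsum_ofReal_inner_sq {H : Type*} [NormedAddCommGroup H] [InnerProductSpace ℝ H]
    {ι : Type*} (e : HilbertBasis ι ℝ H) (x : H) :
    ∑' j, ENNReal.ofReal ((inner ℝ (e j) x) ^ 2) = ENNReal.ofReal (‖x‖ ^ 2) := by
  have h := e.hasSum_inner_mul_inner x x
  have h2 : (fun i => inner ℝ x (e i) * inner ℝ (e i) x) = fun i => (inner ℝ (e i) x) ^ 2 := by
    funext i
    rw [real_inner_comm, sq]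
  rw [h2, real_inner_self_eq_norm_sq] at h
  rw [← ENNReal.ofReal_tsum_of_nonneg (fun i => sq_nonneg _) h.summable, h.tsum_eq]

theorem hsSum_eq_adjoint {H : Type*} [NormedAddCommGroup H] [InnerProductSpace ℝ H]
    [CompleteSpace H] {ι κ : Type*} (a : HilbertBasis ι ℝ H) (b : HilbertBasis κ ℝ H)
    (A : H →L[ℝ] H) :
    hsSum a A = ∑' j, ENNReal.ofReal (‖ContinuousLinearMap.adjoint A (b j)‖ ^ 2) := by
  have h1 : hsSum a A = ∑' i, ∑' j, ENNReal.ofReal ((inner ℝ (b j) (A (a i))) ^ 2) := by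
    unfold hsSum
    refine tsum_congr fun i => ?_
    rw [tsum_ofReal_inner_sq, tsum_ofReal_inner_sq]
  rw [h1, ENNReal.tsum_comm]
  refine tsum_congr fun j => ?_
  rw [← tsum_ofReal_inner_sq a]
  refine tsum_congr fun i => ?_
  rw [ContinuousLinearMap.adjoint_inner_right, real_inner_comm]

/-- The double sum does not depend on the orthonormal basis. -/
theorem hsSum_indep {H : Type*} [NormedAddCommGroup H] [InnerProductSpace ℝ H]
    [CompleteSpace H] {ι κ : Type*} (e : HilbertBasis ι ℝ H) (e' : HilbertBasis κ ℝ H)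
    (A : H →L[ℝ] H) : hsSum e A = hsSum e' A := by
  rw [hsSum_eq_adjoint e e', hsSum_eq_adjoint e' e']

/-- Some orthonormal (Hilbert) basis of a Hilbert space. -/
def someBasis (H : Type*) [NormedAddCommGroup H] [InnerProductSpace ℝ H] [CompleteSpace H] :
    HilbertBasis (exists_hilbertBasis ℝ H).choose ℝ H :=
  (exists_hilbertBasis ℝ H).choose_spec.choose

/-- `A` is a Hilbert-Schmidt operator. -/
def IsHilbertSchmidt {H : Type*} [NormedAddCommGroup H] [InnerProductSpace ℝ H]
    [CompleteSpace H] (A : H →L[ℝ] H) : Prop :=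
  hsSum (someBasis H) A ≠ ∞

/-- The Hilbert-Schmidt norm of `A` (meaningful when `A` is Hilbert-Schmidt). -/
def hsNorm {H : Type*} [NormedAddCommGroup H] [InnerProductSpace ℝ H]
    [CompleteSpace H] (A : H →L[ℝ] H) : ℝ :=
  √ (hsSum (someBasis H) A).toReal

/-- Every orthonormal basis computes the Hilbert-Schmidt norm. -/
theorem hsNorm_eq {H : Type*} [NormedAddCommGroup H] [InnerProductSpace ℝ H]
    [CompleteSpace H] {ι : Type*} (e : HilbertBasis ι ℝ H) (A : H →L[ℝ] H) :
    hsNorm A = √ (hsSum e A).toReal := by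
  rw [hsNorm, hsSum_indep (someBasis H) e]

end HilbertSchmidt

section IntegralOperator

/-- The real Hilbert space `L²(ℝ)`. -/
abbrev L2R : Type := Lp ℝ 2 (volume : Measure ℝ)

theorem eLpNorm_two_sq {α : Type*} [MeasurableSpace α] (μ : Measure α) (g : α → ℝ) :
    eLpNorm g 2 μ ^ 2 = ∫⁻ a, ‖g a‖ₑ ^ 2 ∂μ := by
  have h := eLpNorm_nnreal_pow_eq_lintegral (f := g) (μ := μ) (p := 2) (by norm_num)
  norm_num at h
  exact h

theorem enorm_integral_mul_le {g k : ℝ → ℝ} (hg : MemLp g 2 volume) (hk : MemLp k 2 volume) :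
    ‖∫ x, g x * k x‖ₑ ≤ eLpNorm g 2 volume * eLpNorm k 2 volume := by
  calc ‖∫ x, g x * k x‖ₑ ≤ ∫⁻ x, ‖g x * k x‖ₑ := enorm_integral_le_lintegral_enorm _
    _ = eLpNorm (g • k) 1 volume := eLpNorm_one_eq_lintegral_enorm.symm
    _ ≤ eLpNorm g 2 volume * eLpNorm k 2 volume :=
        eLpNorm_smul_le_mul_eLpNorm (p := 2) (q := 2) (r := 1) hk.1 hg.1

theorem ae_memLp_slice {k : ℝ × ℝ → ℝ} (hk : MemLp k 2 volume) :
    ∀ᵐ x₂ : ℝ, MemLp (fun x₁ => k (x₁, x₂)) 2 volume := by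
  have hkm : AEStronglyMeasurable k ((volume : Measure ℝ).prod volume) := hk.1
  have hks : AEStronglyMeasurable (fun p : ℝ × ℝ => k p.swap)
    ((volume : Measure ℝ).prod volume) := hkm.prod_swap
  have hslice : ∀ᵐ x₂ : ℝ, AEStronglyMeasurable (fun x₁ => k (x₁, x₂)) volume :=
    hks.prodMk_left
  have hslice2 : ∀ᵐ x₂ : ℝ, ∫⁻ x₁ : ℝ, ‖k (x₁, x₂)‖ₑ ^ 2 < ∞ := by
    refine ae_lt_top' (hks.enorm.pow_const 2).lintegral_prod_right' ?_
    have h := eLpNorm_two_sq ((volume : Measure ℝ).prod volume) k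
    rw [lintegral_prod_symm _ (hkm.enorm.pow_const 2)] at h
    rw [← h]
    exact ENNReal.pow_ne_top hk.2.ne
  filter_upwards [hslice, hslice2] with x₂ h1 h2
  refine ⟨h1, ?_⟩
  rw [← eLpNorm_two_sq] at h2
  by_contra hc
  simp only [not_lt, top_le_iff] at hc
  simp [hc] at h2

/-- For a square integrable kernel `k`, `x₂ ↦ ∫ u(x₁) k(x₁, x₂) dx₁` is well defined almost
everywhere and square integrable, with norm at most `‖k‖ ‖u‖`. -/
theorem kernel_integral_spec {k : ℝ × ℝ → ℝ} (hk : MemLp k 2 volume) (u : L2R) :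
    (∀ᵐ x₂ : ℝ, Integrable (fun x₁ => u x₁ * k (x₁, x₂))) ∧
    AEStronglyMeasurable (fun x₂ => ∫ x₁, u x₁ * k (x₁, x₂)) volume ∧
    eLpNorm (fun x₂ => ∫ x₁, u x₁ * k (x₁, x₂)) 2 volume ≤ eLpNorm k 2 volume * ‖u‖ₑ := by
  have hkm : AEStronglyMeasurable k ((volume : Measure ℝ).prod volume) := hk.1
  have hks : AEStronglyMeasurable (fun p : ℝ × ℝ => k p.swap)
    ((volume : Measure ℝ).prod volume) := hkm.prod_swap
  have hu := Lp.memLp u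
  have hslice := ae_memLp_slice hk
  have hm : AEStronglyMeasurable (fun p : ℝ × ℝ => u p.2 * k p.swap)
      ((volume : Measure ℝ).prod volume) := hu.1.comp_snd.mul hks
  refine ⟨?_, hm.integral_prod_right', ?_⟩
  · filter_upwards [hslice] with x₂ h3
    exact hu.integrable_mul h3
  have hcs : ∀ᵐ x₂ : ℝ, ‖∫ x₁, u x₁ * k (x₁, x₂)‖ₑ ^ 2 ≤
      ‖u‖ₑ ^ 2 * ∫⁻ x₁ : ℝ, ‖k (x₁, x₂)‖ₑ ^ 2 := by
    filter_upwards [hslice] with x₂ h3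
    rw [← eLpNorm_two_sq, ← mul_pow, Lp.enorm_def]
    exact pow_le_pow_left' (enorm_integral_mul_le hu h3) 2
  have hfin := eLpNorm_two_sq ((volume : Measure ℝ).prod volume) k
  rw [lintegral_prod_symm _ (hkm.enorm.pow_const 2)] at hfin
  rw [← ENNReal.pow_le_pow_left_iff (n := 2) (by norm_num), eLpNorm_two_sq, mul_pow]
  calc ∫⁻ x₂ : ℝ, ‖∫ x₁, u x₁ * k (x₁, x₂)‖ₑ ^ 2
      ≤ ∫⁻ x₂ : ℝ, ‖u‖ₑ ^ 2 * ∫⁻ x₁ : ℝ, ‖k (x₁, x₂)‖ₑ ^ 2 := lintegral_mono_ae hcs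
    _ = ‖u‖ₑ ^ 2 * ∫⁻ x₂ : ℝ, ∫⁻ x₁ : ℝ, ‖k (x₁, x₂)‖ₑ ^ 2 :=
        lintegral_const_mul' _ _ (ENNReal.pow_ne_top enorm_ne_top)
    _ = eLpNorm k 2 volume ^ 2 * ‖u‖ₑ ^ 2 := by
        rw [← hfin, mul_comm]
        rfl

theorem memLp_kernel_apply {k : ℝ × ℝ → ℝ} (hk : MemLp k 2 volume) (u : L2R) :
    MemLp (fun x₂ => ∫ x₁, u x₁ * k (x₁, x₂)) 2 volume :=
  ⟨(kernel_integral_spec hk u).2.1,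
    (kernel_integral_spec hk u).2.2.trans_lt (ENNReal.mul_lt_top hk.2 enorm_lt_top)⟩

open Classical in
/-- The integral operator `(A u)(x₂) = ∫ u(x₁) k(x₁, x₂) dx₁` on `L²(ℝ)` of a square integrable
kernel `k` (and `0` if `k` is not square integrable). -/
def integralOp (k : ℝ × ℝ → ℝ) : L2R →L[ℝ] L2R :=
  if hk : MemLp k 2 volume then
    LinearMap.mkContinuous
      { toFun := fun u => (memLp_kernel_apply hk u).toLp
        map_add' := by
          intro u v
          rw [← MemLp.toLp_add]
          refine MemLp.toLp_congr _ _ ?_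
          filter_upwards [(kernel_integral_spec hk u).1, (kernel_integral_spec hk v).1]
            with x₂ h1 h2
          rw [Pi.add_apply, ← integral_add h1 h2]
          refine integral_congr_ae ?_
          filter_upwards [Lp.coeFn_add u v] with x₁ h
          rw [h, Pi.add_apply, add_mul]
        map_smul' := by
          intro c u
          rw [RingHom.id_apply, ← MemLp.toLp_const_smul]
          refine MemLp.toLp_congr _ _ (Filter.Eventually.of_forall fun x₂ => ?_)
          simp only [Pi.smul_apply, smul_eq_mul]
          rw [← integral_const_mul]
          refine integral_congr_ae ?_
          filter_upwards [Lp.coeFn_smul c u] with x₁ h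
          rw [h, Pi.smul_apply, smul_eq_mul, mul_assoc] }
      (eLpNorm k 2 volume).toReal (by
        intro u
        simp only [LinearMap.coe_mk, AddHom.coe_mk, Lp.norm_toLp]
        refine (ENNReal.toReal_mono (ENNReal.mul_lt_top hk.2 enorm_lt_top).ne
          (kernel_integral_spec hk u).2.2).trans ?_
        rw [ENNReal.toReal_mul, toReal_enorm])
  else 0

theorem integralOp_apply {k : ℝ × ℝ → ℝ} (hk : MemLp k 2 volume) (u : L2R) :
    integralOp k u =ᵐ[volume] fun x₂ => ∫ x₁, u x₁ * k (x₁, x₂) := by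
  rw [integralOp, dif_pos hk]
  exact (memLp_kernel_apply hk u).coeFn_toLp

open Classical in
/-- The element of `L²(ℝ)` given by a square integrable function (and `0` otherwise). -/
def toL2 (g : ℝ → ℝ) : L2R :=
  if hg : MemLp g 2 volume then hg.toLp g else 0

theorem toL2_coe {g : ℝ → ℝ} (hg : MemLp g 2 volume) : toL2 g =ᵐ[volume] g := by
  rw [toL2, dif_pos hg]
  exact hg.coeFn_toLp

end IntegralOperator

section Estimator

/-- The rescaled kernel `K_h(t) = (1/h) K(t/h)`. -/
def scaled (K : ℝ → ℝ) (h : ℝ) (t : ℝ) : ℝ := (1 / h) * K (t / h)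

/-- The smoothed density `f_h(x₁, x₂) = ∫ f(u, v) K_h(x₁ - u) K_h(x₂ - v) du dv`. -/
def smoothed (K : ℝ → ℝ) (h : ℝ) (f : ℝ × ℝ → ℝ) (x : ℝ × ℝ) : ℝ :=
  ∫ p : ℝ × ℝ, f p * scaled K h (x.1 - p.1) * scaled K h (x.2 - p.2)

/-- The operator `T_h`, with kernel `f_h`. -/
def opT (K : ℝ → ℝ) (h : ℝ) (f : ℝ × ℝ → ℝ) : L2R →L[ℝ] L2R :=
  integralOp (smoothed K h f)

/-- The estimate `f̂_h(x₁, x₂) = (1/N) ∑ᵢ K_h(x₁ - Xᵢ¹) K_h(x₂ - Xᵢ²)` computed from the sample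
points `s i = (Xᵢ¹, Xᵢ²)`. -/
def fHat (K : ℝ → ℝ) (h : ℝ) {N : ℕ} (s : Fin N → ℝ × ℝ) (x : ℝ × ℝ) : ℝ :=
  (1 / (N : ℝ)) * ∑ i, scaled K h (x.1 - (s i).1) * scaled K h (x.2 - (s i).2)

/-- The estimator `T̂_h`, with kernel `f̂_h`. -/
def opTHat (K : ℝ → ℝ) (h : ℝ) {N : ℕ} (s : Fin N → ℝ × ℝ) : L2R →L[ℝ] L2R :=
  integralOp (fHat K h s)

/-- The rank-one operator `T_{h,x} = K_h(x₂ - ·) ⊗ K_h(x₁ - ·)`, that is,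
`w ↦ ⟨K_h(x₁ - ·), w⟩ K_h(x₂ - ·)`. -/
def opTx (K : ℝ → ℝ) (h : ℝ) (x : ℝ × ℝ) : L2R →L[ℝ] L2R :=
  InnerProductSpace.rankOne ℝ
    (toL2 fun y => scaled K h (x.2 - y)) (toL2 fun y => scaled K h (x.1 - y))

/-- `L_h = sup_{x, x'} ‖T_{h,x} - T_{h,x'}‖_HS`. -/
def supL (K : ℝ → ℝ) (h : ℝ) : ℝ :=
  ⨆ q : (ℝ × ℝ) × (ℝ × ℝ), hsNorm (opTx K h q.1 - opTx K h q.2)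

/-- The distribution on `ℝ²` with density `f`. -/
def law (f : ℝ × ℝ → ℝ) : Measure (ℝ × ℝ) :=
  (volume : Measure (ℝ × ℝ)).withDensity fun x => ENNReal.ofReal (f x)

/-- `σ_h² = E ‖T_{h,X} - T_h‖²_HS`, where `X` has density `f`. -/
def sigmaSq (K : ℝ → ℝ) (h : ℝ) (f : ℝ × ℝ → ℝ) : ℝ :=
  ∫ x, hsNorm (opTx K h x - opT K h f) ^ 2 ∂(law f)

/-- The tail bound
`2 exp(-(τ N / L) ln(1 + τ L / σ²)) (1 + τ / L - (σ² / L²) ln(1 + τ L / σ²))^N`. -/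
def tailBound (N : ℕ) (L σ2 τ : ℝ) : ℝ :=
  2 * Real.exp (-(τ * N / L) * Real.log (1 + τ * L / σ2)) *
    (1 + τ / L - σ2 / L ^ 2 * Real.log (1 + τ * L / σ2)) ^ N

/-- The U-statistic `(1 / (N (N - 1))) ∑_{i ≠ j} ‖T_{h,X_i} - T_{h,X_j}‖²_HS`. -/
def uStat (K : ℝ → ℝ) (h : ℝ) {N : ℕ} (s : Fin N → ℝ × ℝ) : ℝ :=
  1 / ((N : ℝ) * ((N : ℝ) - 1)) *
    ∑ p ∈ (Finset.univ : Finset (Fin N)).offDiag,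
      hsNorm (opTx K h (s p.1) - opTx K h (s p.2)) ^ 2

/-- The data-driven threshold `τ̂_h(N, δ)` computed from the sample points `s`. -/
def tauHat (K : ℝ → ℝ) (h : ℝ) {N : ℕ} (δ : ℝ) (s : Fin N → ℝ × ℝ) : ℝ :=
  2 * supL K h * Real.log (2 / δ) / N +
    √ (Real.log (2 / δ) / N *
      (uStat K h s + supL K h ^ 2 * √ (Real.log (1 / δ) / N)))

end Estimator

end MixtureRank

end

/-!
The Hilbert-Schmidt norm of an integral operator is the `L²(ℝ²)` norm of its kernel
(`hsSum_integralOp`), so everything takes place in the Hilbert space `L²(ℝ²)`. With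
`T(y) = K_h(y₁) K_h(y₂)`, the kernel of `T̂_h` is the mean of the translates `T(· - X_i)`, and the
kernel `f_h` of `T_h` is their expectation (`integral_translateLp`). The statement is thus about the
deviation of the mean of independent, identically distributed bounded random vectors in a Hilbert
space from their expectation.

The tail bound is Pinelis' inequality: if `S` and `ξ` are independent and `ξ` is centred, then
`E cosh ‖S + ξ‖ ≤ E cosh ‖S‖ * E (exp ‖ξ‖ - ‖ξ‖)`. In a Hilbert space this follows from a pointwise
inequality (`cosh_norm_add_le`), which reduces to two scalar cases because `u ↦ cosh √u` is convex.
Chernoff's method with the parameter `ln (1 + τ L / σ²) / L` gives the bound in the stated form; it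
is continuous in `τ`, equals `2` at `0` and tends to `0`, whence the value `τ_h(N, δ)`.

For the data-driven bound, the U-statistic has mean `2 v`, where `v` is the variance of the summands.
It is an average over permutations of means of `⌊N / 2⌋` independent terms, which gives Hoeffding's
lower tail (`hasSubgaussianMGF_uStatistic`). For odd `N` that tail is slightly larger than `δ`; the
loss is made up by the constant `2` in front of `L_h ln(2/δ) / N`, which exceeds the constant `2/3`
that Bernstein's inequality needs (`bernstein_exponent`, `two_exp_add_exp_lt`). The threshold exceeds
the largest possible deviation when `N ≤ 2 ln(2/δ)`.

Two points are particular to this model. The kernel of `T_{h,x}` is a translate of the reflection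
of `T`, and `K` need not be even; the reflected family has the same pairwise distances, so `L_h`
and the U-statistic are unaffected, while `σ_h²` is at least the variance `v`
(`variance_le_sigmaSq`), which suffices. And `v > 0` because distinct translates of `T` are distinct
(a nonzero square integrable function has no period, `ae_eq_zero_of_translate_ae_eq`) and the law of
`X` has no atoms.
-/

namespace MixtureRank

/-! ### Exponential and hyperbolic inequalities -/

theorem convexOn_cosh_sqrt : ConvexOn ℝ (Set.Ici 0) fun u : ℝ => Real.cosh (√u) := by
  refine ⟨convex_Ici 0, fun p hp q hq s t hs ht hst => ?_⟩
  have key : ∀ u : ℝ, 0 ≤ u →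
      HasSum (fun n : ℕ => u ^ n / ((2 * n).factorial : ℝ)) (Real.cosh √u) := by
    intro u hu
    have := Real.hasSum_cosh √u
    simpa only [pow_mul, Real.sq_sqrt hu] using this
  have hsum := (key (s • p + t • q) (by
    simp only [smul_eq_mul]
    exact add_nonneg (mul_nonneg hs hp) (mul_nonneg ht hq)))
  refine hasSum_le (fun n => ?_) hsum (((key p hp).mul_left s).add ((key q hq).mul_left t))
  have := (convexOn_pow (𝕜 := ℝ) n).2 hp hq hs ht hst
  simp only [smul_eq_mul] at this ⊢
  rw [mul_div_assoc', mul_div_assoc', ← add_div]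
  gcongr

/-- One step of Pinelis' argument: the left-hand side is convex and the right-hand side affine
in `c`, and for `c = ± a b` the inequality is elementary. -/
theorem cosh_sqrt_add_le {a b c : ℝ} (ha : 0 ≤ a) (hb : 0 ≤ b) (hc : |c| ≤ a * b) :
    Real.cosh √(a ^ 2 + b ^ 2 + 2 * c) ≤
      Real.cosh a * (Real.exp b - b) + c * (Real.sinh a / a) := by
  have hexp : Real.exp b = Real.cosh b + Real.sinh b := (Real.cosh_add_sinh b).symm
  have hsb : b ≤ Real.sinh b := Real.self_le_sinh_iff.2 hb
  have hsa : 0 ≤ Real.sinh a := Real.sinh_nonneg_iff.2 ha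
  have hca : Real.sinh a ≤ Real.cosh a := (Real.sinh_lt_cosh a).le
  rcases (mul_nonneg ha hb).eq_or_lt with h0 | hab
  · have hc0 : c = 0 := by simpa [← h0] using hc
    subst hc0
    rcases mul_eq_zero.1 h0.symm with h | h
    · subst h
      simp only [ne_eq, OfNat.ofNat_ne_zero, not_false_eq_true, zero_pow, mul_zero, add_zero,
        zero_add, Real.sqrt_sq hb, Real.cosh_zero, one_mul, zero_mul]
      linarith
    · subst h
      simp [Real.sqrt_sq ha]
  have ha' : a ≠ 0 := by rintro rfl; simp at hab
  have hb' : b ≠ 0 := by rintro rfl; simp at hab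
  obtain ⟨hc1, hc2⟩ := abs_le.1 hc
  -- `a² + b² + 2c` is the convex combination of `(a - b)²` and `(a + b)²` with weight `w`
  set w : ℝ := (1 + c / (a * b)) / 2 with hw
  have hcw : c = a * b * (2 * w - 1) := by rw [hw]; field_simp; ring
  have hw0 : 0 ≤ w := by
    have : -1 ≤ c / (a * b) := by rw [le_div_iff₀ hab]; linarith
    rw [hw]; linarith
  have hw1 : 0 ≤ 1 - w := by
    have : c / (a * b) ≤ 1 := by rw [div_le_one hab]; exact hc2
    rw [hw]; linarith
  have hconv := convexOn_cosh_sqrt.2 (x := (a - b) ^ 2) (y := (a + b) ^ 2)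
    (Set.mem_Ici.2 (sq_nonneg _)) (Set.mem_Ici.2 (sq_nonneg _)) hw1 hw0 (by ring)
  simp only [smul_eq_mul, Real.sqrt_sq_eq_abs, Real.cosh_abs] at hconv
  have heq : (1 - w) * (a - b) ^ 2 + w * (a + b) ^ 2 = a ^ 2 + b ^ 2 + 2 * c := by
    rw [hcw]; ring
  rw [heq, Real.cosh_sub, Real.cosh_add] at hconv
  have hlin : c * (Real.sinh a / a) = b * (2 * w - 1) * Real.sinh a := by
    rw [hcw]; field_simp
  rw [hlin, hexp]
  have h1 : 0 ≤ (1 - w) * ((Real.sinh b - b) * (Real.cosh a + Real.sinh a)) :=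
    mul_nonneg hw1 (mul_nonneg (by linarith) (by linarith))
  have h2 : 0 ≤ w * ((Real.sinh b - b) * (Real.cosh a - Real.sinh a)) :=
    mul_nonneg hw0 (mul_nonneg (by linarith) (by linarith))
  nlinarith [hconv, h1, h2]

/-- The vector form of `cosh_sqrt_add_le`: the increment of `cosh ‖x‖` exceeds its linear part
by at most `cosh ‖x‖ (exp ‖y‖ - 1 - ‖y‖)`. -/
theorem cosh_norm_add_le {G : Type*} [NormedAddCommGroup G] [InnerProductSpace ℝ G] (x y : G) :
    Real.cosh ‖x + y‖ ≤ Real.cosh ‖x‖ * (Real.exp ‖y‖ - ‖y‖) +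
      inner ℝ ((Real.sinh ‖x‖ / ‖x‖) • x) y := by
  have h := cosh_sqrt_add_le (norm_nonneg x) (norm_nonneg y) (abs_real_inner_le_norm x y)
  have h2 : ‖x‖ ^ 2 + ‖y‖ ^ 2 + 2 * inner ℝ x y = ‖x + y‖ ^ 2 := by
    rw [norm_add_sq_real]; ring
  rw [h2, Real.sqrt_sq (norm_nonneg _)] at h
  rwa [real_inner_smul_left, mul_comm (Real.sinh ‖x‖ / ‖x‖)]

theorem hasSum_exp_sub_one_sub (u : ℝ) :
    HasSum (fun n : ℕ => u ^ (n + 2) / ((n + 2).factorial : ℝ)) (Real.exp u - 1 - u) := by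
  have h := NormedSpace.expSeries_div_hasSum_exp (𝔸 := ℝ) u
  rw [← Real.exp_eq_exp_ℝ] at h
  have := (hasSum_nat_add_iff' 2).2 h
  simpa [Finset.sum_range_succ, sub_sub] using this

/-- `u ↦ (exp u - 1 - u) / u²` is increasing: on the segment `u = t U`, `0 ≤ t ≤ 1`. -/
theorem exp_mul_sub_one_sub_le {t U : ℝ} (ht0 : 0 ≤ t) (ht1 : t ≤ 1) (hU : 0 ≤ U) :
    Real.exp (t * U) - 1 - t * U ≤ t ^ 2 * (Real.exp U - 1 - U) := by
  refine hasSum_le (fun n => ?_) (hasSum_exp_sub_one_sub (t * U))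
    ((hasSum_exp_sub_one_sub U).mul_left (t ^ 2))
  rw [mul_div_assoc', mul_pow]
  gcongr ?_ * _ / _
  exact pow_le_pow_of_le_one ht0 ht1 (by omega)

/-- Bernstein's bound for the exponential remainder, from `(n + 2)! ≥ 2 * 3 ^ n`. -/
theorem exp_sub_one_sub_le {u : ℝ} (h0 : 0 ≤ u) (h3 : u < 3) :
    Real.exp u - 1 - u ≤ u ^ 2 / (2 * (1 - u / 3)) := by
  have hg := (hasSum_geometric_of_lt_one (r := u / 3) (by positivity) (by linarith)).mul_left
    (u ^ 2 / 2)
  have heq : u ^ 2 / (2 * (1 - u / 3)) = u ^ 2 / 2 * (1 - u / 3)⁻¹ := by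
    rw [← div_eq_mul_inv, div_div]
  rw [heq]
  refine hasSum_le (fun n => ?_) (hasSum_exp_sub_one_sub u) hg
  have hfac : 2 * 3 ^ n ≤ (n + 2).factorial := by
    have := Nat.factorial_mul_pow_le_factorial (m := 2) (n := n)
    rw [Nat.factorial_two] at this
    rwa [add_comm n 2]
  have hfac' : (2 * 3 ^ n : ℝ) ≤ ((n + 2).factorial : ℝ) := by exact_mod_cast hfac
  calc u ^ (n + 2) / ((n + 2).factorial : ℝ) ≤ u ^ (n + 2) / (2 * 3 ^ n) := by gcongr
    _ = u ^ 2 / 2 * (u / 3) ^ n := by rw [pow_add, div_pow]; field_simp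

/-! ### Exponential moments of sums of independent vectors in a Hilbert space -/

section Pinelis

variable {Ω : Type*} [MeasurableSpace Ω] {P : Measure Ω} [IsProbabilityMeasure P]
  {G : Type*} [NormedAddCommGroup G] [InnerProductSpace ℝ G] [CompleteSpace G]
  [SecondCountableTopology G] [MeasurableSpace G] [BorelSpace G]

theorem integral_cosh_norm_add_le_of_indepFun {A B : Ω → G} (hA : Measurable A)
    (hB : Measurable B) (hind : IndepFun A B P) {a b : ℝ} (hAb : ∀ ω, ‖A ω‖ ≤ a)
    (hBb : ∀ ω, ‖B ω‖ ≤ b) (hB0 : ∫ ω, B ω ∂P = 0) :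
    ∫ ω, Real.cosh ‖A ω + B ω‖ ∂P ≤
      (∫ ω, Real.cosh ‖A ω‖ ∂P) * ∫ ω, (Real.exp ‖B ω‖ - ‖B ω‖) ∂P := by
  have hBi : Integrable B P := .of_bound hB.aestronglyMeasurable b (.of_forall hBb)
  have hq : Measurable fun x : G => (Real.sinh ‖x‖ / ‖x‖) • x := by fun_prop
  have hqi : Integrable (fun ω => (Real.sinh ‖A ω‖ / ‖A ω‖) • A ω) P := by
    refine .of_bound (hq.comp hA).aestronglyMeasurable (Real.sinh a) (.of_forall fun ω => ?_)
    rw [norm_smul, norm_div, norm_norm, Real.norm_eq_abs, Real.abs_sinh, abs_norm]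
    refine le_trans ?_ (Real.sinh_le_sinh.2 (hAb ω))
    rcases eq_or_ne ‖A ω‖ 0 with h | h
    · simp [h]
    · rw [div_mul_cancel₀ _ h]
  have hci : Integrable (fun ω => Real.cosh ‖A ω‖) P := by
    refine .of_bound (by fun_prop) (Real.cosh a) (.of_forall fun ω => ?_)
    rw [Real.norm_of_nonneg (Real.cosh_pos _).le, Real.cosh_le_cosh, abs_norm]
    exact (hAb ω).trans (le_abs_self a)
  have hei : Integrable (fun ω => Real.exp ‖B ω‖ - ‖B ω‖) P := by
    refine Integrable.sub ?_ hBi.norm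
    refine .of_bound (by fun_prop) (Real.exp b) (.of_forall fun ω => ?_)
    rw [Real.norm_eq_abs, Real.abs_exp]
    exact Real.exp_le_exp.2 (hBb ω)
  have hsi : Integrable (fun ω => Real.cosh ‖A ω + B ω‖) P := by
    refine .of_bound (by fun_prop) (Real.cosh (a + b)) (.of_forall fun ω => ?_)
    rw [Real.norm_of_nonneg (Real.cosh_pos _).le, Real.cosh_le_cosh, abs_norm]
    exact (norm_add_le _ _).trans ((add_le_add (hAb ω) (hBb ω)).trans (le_abs_self _))
  have hind1 : IndepFun (fun ω => Real.cosh ‖A ω‖) (fun ω => Real.exp ‖B ω‖ - ‖B ω‖) P :=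
    hind.comp (φ := fun x => Real.cosh ‖x‖) (ψ := fun x => Real.exp ‖x‖ - ‖x‖)
      (by fun_prop) (by fun_prop)
  have hind2 : IndepFun (fun ω => (Real.sinh ‖A ω‖ / ‖A ω‖) • A ω) B P :=
    hind.comp (φ := fun x => (Real.sinh ‖x‖ / ‖x‖) • x) (ψ := id) hq measurable_id
  have hlin : ∫ ω, inner ℝ ((Real.sinh ‖A ω‖ / ‖A ω‖) • A ω) (B ω) ∂P = 0 := by
    have := hind2.integral_bilin hqi hBi (innerSL ℝ)
    rw [hB0, map_zero] at this
    exact this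
  have hlini : Integrable (fun ω => inner ℝ ((Real.sinh ‖A ω‖ / ‖A ω‖) • A ω) (B ω)) P := by
    exact hind2.integrable_bilin hqi hBi (innerSL ℝ)
  have hmuli : Integrable (fun ω => Real.cosh ‖A ω‖ * (Real.exp ‖B ω‖ - ‖B ω‖)) P :=
    hind1.integrable_mul hci hei
  calc ∫ ω, Real.cosh ‖A ω + B ω‖ ∂P
      ≤ ∫ ω, (Real.cosh ‖A ω‖ * (Real.exp ‖B ω‖ - ‖B ω‖) +
          inner ℝ ((Real.sinh ‖A ω‖ / ‖A ω‖) • A ω) (B ω)) ∂P :=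
        integral_mono hsi (hmuli.add hlini) fun ω => cosh_norm_add_le _ _
    _ = (∫ ω, Real.cosh ‖A ω‖ ∂P) * ∫ ω, (Real.exp ‖B ω‖ - ‖B ω‖) ∂P := by
        rw [integral_add hmuli hlini, hlin, add_zero]
        exact hind1.integral_fun_mul_eq_mul_integral hci.1 hei.1

/-- Pinelis' bound for the exponential moment of the norm of a sum of independent, centred and
bounded random vectors in a Hilbert space. -/
theorem integral_cosh_norm_sum_le {ι : Type*} {ξ : ι → Ω → G} (hm : ∀ i, Measurable (ξ i))
    (hind : iIndepFun ξ P) {L v : ℝ} (hL : 0 < L) (hb : ∀ i ω, ‖ξ i ω‖ ≤ L)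
    (h0 : ∀ i, ∫ ω, ξ i ω ∂P = 0) (hv : ∀ i, ∫ ω, ‖ξ i ω‖ ^ 2 ∂P ≤ v) {s : ℝ} (hs : 0 ≤ s)
    (S : Finset ι) :
    ∫ ω, Real.cosh (s * ‖∑ i ∈ S, ξ i ω‖) ∂P ≤
      (1 + v / L ^ 2 * (Real.exp (s * L) - 1 - s * L)) ^ S.card := by
  classical
  have hΨ : 0 ≤ Real.exp (s * L) - 1 - s * L := by
    have := Real.add_one_le_exp (s * L); linarith
  have hnorm : ∀ x : G, s * ‖x‖ = ‖s • x‖ := fun x => by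
    rw [norm_smul, Real.norm_of_nonneg hs]
  induction S using Finset.induction_on with
  | empty => simp
  | insert i S hi ih =>
    have hsum : Measurable fun ω => ∑ j ∈ S, ξ j ω := Finset.measurable_sum _ fun j _ => hm j
    have hind' : IndepFun (fun ω => s • ∑ j ∈ S, ξ j ω) (fun ω => s • ξ i ω) P := by
      have h := hind.indepFun_finsetSum_of_notMem hm hi
      have := h.comp (φ := fun x : G => s • x) (ψ := fun x : G => s • x) (by fun_prop)
        (by fun_prop)
      simpa [Function.comp_def, Finset.sum_apply] using this
    have hAb : ∀ ω, ‖s • ∑ j ∈ S, ξ j ω‖ ≤ s * (S.card * L) := by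
      intro ω
      rw [← hnorm]
      refine mul_le_mul_of_nonneg_left ?_ hs
      refine (norm_sum_le_of_le S fun j _ => hb j ω).trans (by simp)
    have hBb : ∀ ω, ‖s • ξ i ω‖ ≤ s * L := by
      intro ω
      rw [← hnorm]
      exact mul_le_mul_of_nonneg_left (hb i ω) hs
    have hstep := integral_cosh_norm_add_le_of_indepFun (hsum.const_smul s) ((hm i).const_smul s)
      hind' hAb hBb (by
        show ∫ ω, s • ξ i ω ∂P = 0
        rw [integral_smul, h0, smul_zero])
    have hsq : Integrable (fun ω => ‖ξ i ω‖ ^ 2) P := by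
      refine .of_bound (by fun_prop) (L ^ 2) (.of_forall fun ω => ?_)
      rw [norm_pow, norm_norm]
      exact pow_le_pow_left₀ (norm_nonneg _) (hb i ω) 2
    have hfac : ∫ ω, (Real.exp ‖s • ξ i ω‖ - ‖s • ξ i ω‖) ∂P ≤
        1 + v / L ^ 2 * (Real.exp (s * L) - 1 - s * L) := by
      have hle : ∀ ω, Real.exp ‖s • ξ i ω‖ - ‖s • ξ i ω‖ ≤
          1 + ‖ξ i ω‖ ^ 2 * ((Real.exp (s * L) - 1 - s * L) / L ^ 2) := by
        intro ω
        have h := exp_mul_sub_one_sub_le (t := ‖ξ i ω‖ / L) (U := s * L) (by positivity)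
          ((div_le_one hL).2 (hb i ω)) (by positivity)
        have he : ‖ξ i ω‖ / L * (s * L) = ‖s • ξ i ω‖ := by
          rw [← hnorm]; field_simp
        rw [he, div_pow, div_mul_eq_mul_div, mul_div_assoc] at h
        linarith
      have hint : Integrable (fun ω => 1 + ‖ξ i ω‖ ^ 2 *
          ((Real.exp (s * L) - 1 - s * L) / L ^ 2)) P :=
        (integrable_const _).add (hsq.mul_const _)
      refine (integral_mono_of_nonneg (.of_forall fun ω => ?_) hint (.of_forall hle)).trans ?_
      · have := Real.add_one_le_exp ‖s • ξ i ω‖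
        simp only [Pi.zero_apply]; linarith
      · rw [integral_add (integrable_const _) (hsq.mul_const _), integral_mul_const]
        simp only [integral_const, probReal_univ, one_smul]
        have := mul_le_mul_of_nonneg_right (hv i)
          (div_nonneg hΨ (sq_nonneg L))
        calc _ ≤ 1 + v * ((Real.exp (s * L) - 1 - s * L) / L ^ 2) := by linarith
          _ = _ := by ring
    have hfac0 : 0 ≤ ∫ ω, (Real.exp ‖s • ξ i ω‖ - ‖s • ξ i ω‖) ∂P := by
      refine integral_nonneg fun ω => ?_
      have := Real.add_one_le_exp ‖s • ξ i ω‖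
      simp only [Pi.zero_apply]; linarith
    rw [Finset.card_insert_of_notMem hi, pow_succ]
    simp only [hnorm] at ih ⊢
    have hcomm : ∀ ω, ‖s • ∑ j ∈ insert i S, ξ j ω‖ = ‖s • ∑ j ∈ S, ξ j ω + s • ξ i ω‖ := by
      intro ω; rw [Finset.sum_insert hi, ← smul_add, add_comm]
    simp only [hcomm]
    refine hstep.trans ?_
    exact mul_le_mul ih hfac hfac0
      ((integral_nonneg fun ω => (Real.cosh_pos _).le).trans ih)

/-- The Pinelis-Sakhanenko tail bound, with the free parameter `s` of Chernoff's method. -/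
theorem measure_lt_norm_sum_le {N : ℕ} {ξ : Fin N → Ω → G} (hm : ∀ i, Measurable (ξ i))
    (hind : iIndepFun ξ P) {L v : ℝ} (hL : 0 < L) (hb : ∀ i ω, ‖ξ i ω‖ ≤ L)
    (h0 : ∀ i, ∫ ω, ξ i ω ∂P = 0) (hv : ∀ i, ∫ ω, ‖ξ i ω‖ ^ 2 ∂P ≤ v) {s : ℝ} (hs : 0 ≤ s)
    {t : ℝ} (ht : 0 ≤ t) :
    P.real {ω | t < ‖∑ i, ξ i ω‖} ≤
      2 * Real.exp (-(s * t)) * (1 + v / L ^ 2 * (Real.exp (s * L) - 1 - s * L)) ^ N := by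
  have hmain := integral_cosh_norm_sum_le hm hind hL hb h0 hv hs Finset.univ
  rw [Finset.card_univ, Fintype.card_fin] at hmain
  have hsum : Measurable fun ω => ∑ j, ξ j ω := Finset.measurable_sum _ fun j _ => hm j
  have hint : Integrable (fun ω => Real.cosh (s * ‖∑ i, ξ i ω‖)) P := by
    refine .of_bound (by fun_prop) (Real.cosh (s * (N * L))) (.of_forall fun ω => ?_)
    rw [Real.norm_of_nonneg (Real.cosh_pos _).le, Real.cosh_le_cosh, abs_of_nonneg (by positivity),
      abs_of_nonneg (by positivity)]
    refine mul_le_mul_of_nonneg_left ?_ hs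
    exact (norm_sum_le_of_le _ fun j _ => hb j ω).trans (by simp)
  have hmarkov := mul_meas_ge_le_integral_of_nonneg (μ := P)
    (f := fun ω => Real.cosh (s * ‖∑ i, ξ i ω‖)) (.of_forall fun ω => (Real.cosh_pos _).le)
    hint (Real.cosh (s * t))
  have hsub : P.real {ω | t < ‖∑ i, ξ i ω‖} ≤
      P.real {ω | Real.cosh (s * t) ≤ Real.cosh (s * ‖∑ i, ξ i ω‖)} := by
    refine measureReal_mono (fun ω hω => ?_) (measure_ne_top _ _)
    have hω' : t < ‖∑ i, ξ i ω‖ := hω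
    show Real.cosh (s * t) ≤ Real.cosh (s * ‖∑ i, ξ i ω‖)
    rw [Real.cosh_le_cosh, abs_of_nonneg (by positivity), abs_of_nonneg (by positivity)]
    exact mul_le_mul_of_nonneg_left hω'.le hs
  have hcosh : Real.exp (s * t) / 2 ≤ Real.cosh (s * t) := by
    rw [Real.cosh_eq]; have := Real.exp_pos (-(s * t)); linarith
  have h1 : Real.exp (s * t) / 2 * P.real {ω | t < ‖∑ i, ξ i ω‖} ≤
      (1 + v / L ^ 2 * (Real.exp (s * L) - 1 - s * L)) ^ N :=
    (mul_le_mul hcosh hsub measureReal_nonneg (Real.cosh_pos _).le).trans (hmarkov.trans hmain)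
  calc P.real {ω | t < ‖∑ i, ξ i ω‖}
      = 2 * Real.exp (-(s * t)) * (Real.exp (s * t) / 2 * P.real {ω | t < ‖∑ i, ξ i ω‖}) := by
        rw [Real.exp_neg]; field_simp
    _ ≤ _ := mul_le_mul_of_nonneg_left h1 (by positivity)

end Pinelis

/-! ### Hoeffding's inequality for U-statistics of order two -/

section UStatistic

/-- The permutations of a finite set average a function of a fixed pair of distinct points to
its mean over all pairs of distinct points. -/
theorem card_offDiag_mul_sum_perm {α : Type*} [Fintype α] [DecidableEq α] {a b : α} (hab : a ≠ b)
    (F : α × α → ℝ) :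
    ((Finset.univ : Finset α).offDiag.card : ℝ) * ∑ σ : Equiv.Perm α, F (σ a, σ b) =
      (Fintype.card (Equiv.Perm α) : ℝ) * ∑ p ∈ (Finset.univ : Finset α).offDiag, F p := by
  have h1 : ∀ p ∈ (Finset.univ : Finset α).offDiag,
      ∑ σ : Equiv.Perm α, F (σ p.1, σ p.2) = ∑ σ : Equiv.Perm α, F (σ a, σ b) := by
    rintro ⟨c, d⟩ hp
    have hcd : c ≠ d := by simpa using hp
    obtain ⟨π, hπa, hπb⟩ : ∃ π : Equiv.Perm α, π a = c ∧ π b = d := by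
      refine ⟨Equiv.swap (Equiv.swap a c b) d * Equiv.swap a c, ?_, ?_⟩
      · rw [Equiv.Perm.mul_apply, Equiv.swap_apply_left]
        refine Equiv.swap_apply_of_ne_of_ne (fun h => hab ?_) hcd
        exact (Equiv.swap a c).injective (by rw [Equiv.swap_apply_left]; exact h)
      · rw [Equiv.Perm.mul_apply, Equiv.swap_apply_left]
    simp only [← hπa, ← hπb]
    exact Equiv.sum_comp (Equiv.mulRight π) fun σ : Equiv.Perm α => F (σ a, σ b)
  have h2 : ∀ σ : Equiv.Perm α, ∑ p ∈ (Finset.univ : Finset α).offDiag, F (σ p.1, σ p.2) =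
      ∑ p ∈ (Finset.univ : Finset α).offDiag, F p := fun σ =>
    Finset.sum_equiv (Equiv.prodCongr σ σ) (by simp) (by simp)
  rw [← nsmul_eq_mul, ← Finset.sum_const, ← Finset.sum_congr rfl h1, Finset.sum_comm,
    Finset.sum_congr rfl fun σ _ => h2 σ, Finset.sum_const, nsmul_eq_mul, Finset.card_univ]

variable {Ω : Type*} [MeasurableSpace Ω] {P : Measure Ω}

/-- By Jensen's inequality, averages of sub-Gaussian variables with the same parameter are
sub-Gaussian with that parameter; no independence is needed. -/
theorem hasSubgaussianMGF_average {ι : Type*} [Fintype ι] [Nonempty ι] {Y : ι → Ω → ℝ}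
    {c : NNReal} (hY : ∀ i, HasSubgaussianMGF (Y i) c P) :
    HasSubgaussianMGF (fun ω => (Fintype.card ι : ℝ)⁻¹ * ∑ i, Y i ω) c P := by
  have hn : (Fintype.card ι : ℝ) ≠ 0 := by positivity
  have hjensen : ∀ t ω, Real.exp (t * ((Fintype.card ι : ℝ)⁻¹ * ∑ i, Y i ω)) ≤
      ∑ i, (Fintype.card ι : ℝ)⁻¹ * Real.exp (t * Y i ω) := by
    intro t ω
    have h := convexOn_exp.map_sum_le (t := (Finset.univ : Finset ι))
      (w := fun _ => (Fintype.card ι : ℝ)⁻¹) (p := fun i => t * Y i ω)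
      (fun _ _ => by positivity) (by simp) (fun _ _ => Set.mem_univ _)
    simp only [smul_eq_mul] at h
    refine le_trans (le_of_eq ?_) h
    rw [Finset.mul_sum, Finset.mul_sum]
    exact congrArg Real.exp (Finset.sum_congr rfl fun i _ => by ring)
  have hint : ∀ t : ℝ, Integrable (fun ω => ∑ i, (Fintype.card ι : ℝ)⁻¹ *
      Real.exp (t * Y i ω)) P := fun t =>
    integrable_finsetSum _ fun i _ => ((hY i).integrable_exp_mul t).const_mul _
  have hm : AEMeasurable (fun ω => (Fintype.card ι : ℝ)⁻¹ * ∑ i, Y i ω) P :=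
    (Finset.aemeasurable_fun_sum _ fun i _ => (hY i).aemeasurable).const_mul _
  refine ⟨fun t => (hint t).mono'
    (hm.const_mul t).exp.aestronglyMeasurable (.of_forall fun ω => ?_), fun t => ?_⟩
  · rw [Real.norm_eq_abs, Real.abs_exp]
    exact hjensen t ω
  · calc mgf _ P t ≤ ∫ ω, ∑ i, (Fintype.card ι : ℝ)⁻¹ * Real.exp (t * Y i ω) ∂P :=
          integral_mono_of_nonneg (.of_forall fun ω => (Real.exp_pos _).le) (hint t)
            (.of_forall (hjensen t))
      _ = ∑ i, (Fintype.card ι : ℝ)⁻¹ * mgf (Y i) P t := by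
          rw [integral_finsetSum _ fun i _ => ((hY i).integrable_exp_mul t).const_mul _]
          simp only [integral_const_mul, mgf]
      _ ≤ ∑ _i : ι, (Fintype.card ι : ℝ)⁻¹ * Real.exp (c * t ^ 2 / 2) := by
          gcongr with i
          exact (hY i).mgf_le t
      _ = Real.exp (c * t ^ 2 / 2) := by
          rw [Finset.sum_const, Finset.card_univ, nsmul_eq_mul, mul_inv_cancel_left₀ hn]

variable [IsProbabilityMeasure P] {E : Type*} [MeasurableSpace E] {μ : Measure E} {ι : Type*} {X : ι → Ω → E}

theorem integral_pair_eq (hX : ∀ i, Measurable (X i)) (hind : iIndepFun X P)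
    (hlaw : ∀ i, P.map (X i) = μ) {g : E × E → ℝ} (hg : Measurable g) {i j : ι} (hij : i ≠ j) :
    ∫ ω, g (X i ω, X j ω) ∂P = ∫ p, g p ∂(μ.prod μ) := by
  have h := (indepFun_iff_map_prod_eq_prod_map_map (hX i).aemeasurable
    (hX j).aemeasurable).1 (hind.indepFun hij)
  rw [hlaw, hlaw] at h
  rw [← h, integral_map (by fun_prop) hg.aestronglyMeasurable]

theorem hasSubgaussianMGF_sum_pairs (hX : ∀ i, Measurable (X i))
    (hind : iIndepFun X P) (hlaw : ∀ i, P.map (X i) = μ) {g : E × E → ℝ} (hg : Measurable g)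
    {B : ℝ} (hgB : ∀ p, g p ∈ Set.Icc 0 B) {κ : Type*} {e : κ × Bool → ι}
    (he : Function.Injective e) (S : Finset κ) :
    HasSubgaussianMGF (fun ω => ∑ j ∈ S, (g (X (e (j, false)) ω, X (e (j, true)) ω) -
      ∫ p, g p ∂(μ.prod μ))) (S.card • (‖B - 0‖₊ / 2) ^ 2) P := by
  classical
  induction S using Finset.induction_on with
  | empty => simp
  | insert i S hi ih =>
    have hone : HasSubgaussianMGF (fun ω => g (X (e (i, false)) ω, X (e (i, true)) ω) -
        ∫ p, g p ∂(μ.prod μ)) ((‖B - 0‖₊ / 2) ^ 2) P := by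
      have h := hasSubgaussianMGF_of_mem_Icc (μ := P) (a := 0) (b := B)
        (X := fun ω => g (X (e (i, false)) ω, X (e (i, true)) ω)) (by fun_prop)
        (.of_forall fun ω => hgB _)
      rwa [integral_pair_eq hX hind hlaw hg (he.ne (by simp))] at h
    have hindep : IndepFun (fun ω => g (X (e (i, false)) ω, X (e (i, true)) ω) -
        ∫ p, g p ∂(μ.prod μ)) (fun ω => ∑ j ∈ S, (g (X (e (j, false)) ω, X (e (j, true)) ω) -
          ∫ p, g p ∂(μ.prod μ))) P := by
      have hdisj : Disjoint (({i} : Finset κ) ×ˢ (Finset.univ : Finset Bool))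
          (S ×ˢ (Finset.univ : Finset Bool)) := by
        rw [Finset.disjoint_left]
        rintro ⟨j, β⟩ h1 h2
        simp only [Finset.mem_product, Finset.mem_singleton, Finset.mem_univ, and_true] at h1 h2
        exact hi (h1 ▸ h2)
      have h := (hind.precomp he).indepFun_finset _ _ hdisj fun i => hX (e i)
      let φ : ((({i} : Finset κ) ×ˢ (Finset.univ : Finset Bool) : Finset (κ × Bool)) → E) → ℝ :=
        fun x => g (x ⟨(i, false), by simp⟩, x ⟨(i, true), by simp⟩) - ∫ p, g p ∂(μ.prod μ)
      let ψ : ((S ×ˢ (Finset.univ : Finset Bool) : Finset (κ × Bool)) → E) → ℝ :=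
        fun x => ∑ j ∈ S.attach, (g (x ⟨(j.1, false), by simp [j.2]⟩,
          x ⟨(j.1, true), by simp [j.2]⟩) - ∫ p, g p ∂(μ.prod μ))
      have := h.comp (φ := φ) (ψ := ψ) (by fun_prop)
        (Finset.measurable_sum _ fun j _ => by fun_prop)
      have hψ : ψ ∘ (fun ω (x : (S ×ˢ (Finset.univ : Finset Bool) : Finset (κ × Bool))) =>
          X (e x) ω) = fun ω => ∑ j ∈ S, (g (X (e (j, false)) ω, X (e (j, true)) ω) -
          ∫ p, g p ∂(μ.prod μ)) := by
        funext ω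
        exact Finset.sum_attach S fun j => (g (X (e (j, false)) ω, X (e (j, true)) ω) -
          ∫ p, g p ∂(μ.prod μ))
      rw [← hψ]
      exact this
    have := hone.add_of_indepFun ih hindep
    simp only [Finset.sum_insert hi, Finset.card_insert_of_notMem hi, succ_nsmul']
    exact this

/-- Hoeffding's inequality for U-statistics of order two: the U-statistic is the average over all
permutations of means of `⌊N / 2⌋` independent terms. -/
theorem hasSubgaussianMGF_uStatistic {N : ℕ} (hN : 2 ≤ N) {X : Fin N → Ω → E}
    (hX : ∀ i, Measurable (X i)) (hind : iIndepFun X P) (hlaw : ∀ i, P.map (X i) = μ)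
    {g : E × E → ℝ} (hg : Measurable g) {B : ℝ} (hgB : ∀ p, g p ∈ Set.Icc 0 B) :
    HasSubgaussianMGF (fun ω => 1 / ((N : ℝ) * ((N : ℝ) - 1)) *
        ∑ p ∈ (Finset.univ : Finset (Fin N)).offDiag, g (X p.1 ω, X p.2 ω) -
      ∫ p, g p ∂(μ.prod μ)) (((N / 2 : ℕ) : NNReal)⁻¹ * (‖B - 0‖₊ / 2) ^ 2) P := by
  classical
  set k := N / 2 with hk
  set θ := ∫ p, g p ∂(μ.prod μ) with hθ
  have hk0 : 0 < k := by omega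
  have hkR : (k : ℝ) ≠ 0 := by positivity
  have hk' : (k : NNReal) ≠ 0 := by positivity
  let e : Fin k × Bool → Fin N := fun q => ⟨2 * q.1 + q.2.toNat, by
    have h1 := q.1.2; have h2 := Bool.toNat_lt q.2; omega⟩
  have he : Function.Injective e := by
    rintro ⟨a, β⟩ ⟨b, γ⟩ h
    simp only [e, Fin.mk.injEq] at h
    have h2 := Bool.toNat_lt β
    have h3 := Bool.toNat_lt γ
    refine Prod.ext (Fin.ext (by simp only; omega)) ?_
    have h4 : β.toNat = γ.toNat := by omega
    cases β <;> cases γ <;> simp_all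
  have hperm : ∀ σ : Equiv.Perm (Fin N), HasSubgaussianMGF (fun ω => (k : ℝ)⁻¹ *
      ∑ j, (g (X (σ (e (j, false))) ω, X (σ (e (j, true))) ω) - θ))
      ((k : NNReal)⁻¹ * (‖B - 0‖₊ / 2) ^ 2) P := by
    intro σ
    have h := (hasSubgaussianMGF_sum_pairs hX hind hlaw hg hgB (e := fun q => σ (e q))
      (σ.injective.comp he) Finset.univ).const_mul (k : ℝ)⁻¹
    convert h using 1
    rw [Finset.card_univ, Fintype.card_fin, nsmul_eq_mul]
    refine NNReal.eq ?_
    show ((k : ℝ))⁻¹ * (‖B - 0‖ / 2) ^ 2 = ((k : ℝ)⁻¹ ^ 2) * ((k : ℝ) * (‖B - 0‖ / 2) ^ 2)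
    field_simp
  have havg := hasSubgaussianMGF_average hperm
  convert havg using 1
  funext ω
  set F : Fin N × Fin N → ℝ := fun p => g (X p.1 ω, X p.2 ω) with hF
  have hNR : (2 : ℝ) ≤ N := by exact_mod_cast hN
  have hcard : ((Finset.univ : Finset (Fin N)).offDiag.card : ℝ) = N * (N - 1) := by
    rw [Finset.offDiag_card, Finset.card_univ, Fintype.card_fin, Nat.cast_sub (by nlinarith)]
    push_cast; ring
  have hoff : (N : ℝ) * (N - 1) ≠ 0 := by nlinarith
  have hM : (Fintype.card (Equiv.Perm (Fin N)) : ℝ) ≠ 0 := by positivity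
  have hj : ∀ j : Fin k, ∑ σ : Equiv.Perm (Fin N), F (σ (e (j, false)), σ (e (j, true))) =
      (Fintype.card (Equiv.Perm (Fin N)) : ℝ) * (1 / ((N : ℝ) * (N - 1)) *
        ∑ p ∈ (Finset.univ : Finset (Fin N)).offDiag, F p) := by
    intro j
    have h := card_offDiag_mul_sum_perm (a := e (j, false)) (b := e (j, true))
      (he.ne (by simp)) F
    rw [hcard] at h
    rw [one_div, ← mul_assoc, mul_comm (Fintype.card _ : ℝ), mul_assoc, ← h,
      inv_mul_cancel_left₀ hoff]
  show 1 / ((N : ℝ) * (N - 1)) * ∑ p ∈ (Finset.univ : Finset (Fin N)).offDiag, F p - θ =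
    (Fintype.card (Equiv.Perm (Fin N)) : ℝ)⁻¹ * ∑ σ : Equiv.Perm (Fin N), (k : ℝ)⁻¹ *
      ∑ j, (F (σ (e (j, false)), σ (e (j, true))) - θ)
  rw [← Finset.mul_sum, Finset.sum_comm]
  simp only [Finset.sum_sub_distrib, hj, Finset.sum_const, Finset.card_univ, Fintype.card_fin,
    nsmul_eq_mul]
  field_simp

end UStatistic

/-! ### The tail bound and Bernstein's exponent as real functions -/

section RealInequalities

/-- The choice `s = ln (1 + τ L / σ²) / L` of Chernoff's parameter produces `tailBound`. -/
theorem chernoff_eq_tailBound (N : ℕ) {L σ2 τ : ℝ} (hL : 0 < L) (hσ : 0 < σ2) (hτ : 0 < τ) :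
    2 * Real.exp (-(1 / L * Real.log (1 + τ * L / σ2) * (N * τ))) *
      (1 + σ2 / L ^ 2 * (Real.exp (1 / L * Real.log (1 + τ * L / σ2) * L) - 1 -
        1 / L * Real.log (1 + τ * L / σ2) * L)) ^ N = tailBound N L σ2 τ := by
  have h1 : 1 / L * Real.log (1 + τ * L / σ2) * L = Real.log (1 + τ * L / σ2) := by field_simp
  rw [h1, Real.exp_log (by positivity), tailBound]
  congr 2
  · congr 2; ring
  · field_simp; ring

theorem continuousOn_tailBound (N : ℕ) {L σ2 : ℝ} (hL : 0 < L) (hσ : 0 < σ2) :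
    ContinuousOn (tailBound N L σ2) (Set.Ici 0) := by
  have hlog : ContinuousOn (fun τ : ℝ => Real.log (1 + τ * L / σ2)) (Set.Ici 0) := by
    refine ContinuousOn.log (by fun_prop) fun τ hτ => ?_
    have : 0 ≤ τ * L / σ2 := div_nonneg (mul_nonneg hτ hL.le) hσ.le
    positivity
  unfold tailBound
  fun_prop

theorem tailBound_le {N : ℕ} (hN : 1 ≤ N) {L σ2 τ : ℝ} (hL : 0 < L) (hσ : 0 < σ2) (hτ : 0 ≤ τ)
    (hbig : 2 ≤ Real.log (1 + τ * L / σ2)) : tailBound N L σ2 τ ≤ 2 * Real.exp (-(τ / L)) := by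
  set l := Real.log (1 + τ * L / σ2) with hl
  have hl1 : l ≤ τ * L / σ2 := by
    have := Real.log_le_sub_one_of_pos (x := 1 + τ * L / σ2) (by positivity)
    rw [← hl] at this; linarith
  have h0 : 0 ≤ 1 + τ / L - σ2 / L ^ 2 * l := by
    have : σ2 / L ^ 2 * l ≤ σ2 / L ^ 2 * (τ * L / σ2) := by gcongr
    have h2 : σ2 / L ^ 2 * (τ * L / σ2) = τ / L := by field_simp
    linarith
  have h1 : 1 + τ / L - σ2 / L ^ 2 * l ≤ Real.exp (τ / L) := by
    have := Real.add_one_le_exp (τ / L)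
    have h2 : 0 ≤ σ2 / L ^ 2 * l := by positivity
    linarith
  have hNr : (1 : ℝ) ≤ N := by exact_mod_cast hN
  have hτL : 0 ≤ τ / L := by positivity
  calc tailBound N L σ2 τ
      ≤ 2 * Real.exp (-(N * (τ / L)) * 2) * Real.exp (τ / L) ^ N := by
        unfold tailBound
        rw [← hl]
        gcongr 2 * Real.exp ?_ * ?_ ^ N
        have : N * (τ / L) * 2 ≤ N * (τ / L) * l := by gcongr
        calc -(τ * N / L) * l = -(N * (τ / L) * l) := by ring
          _ ≤ _ := by linarith
    _ = 2 * Real.exp (-(N * (τ / L))) := by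
        rw [← Real.exp_nat_mul, mul_assoc, ← Real.exp_add]
        congr 2; ring
    _ ≤ 2 * Real.exp (-(τ / L)) := by
        gcongr
        nlinarith

/-- `tailBound` is continuous, equals `2` at `0` and tends to `0` at infinity. -/
theorem exists_tailBound_eq {N : ℕ} (hN : 1 ≤ N) {L σ2 δ : ℝ} (hL : 0 < L) (hσ : 0 < σ2)
    (hδ : 0 < δ) (hδ1 : δ < 2) : ∃ τ : ℝ, 0 < τ ∧ tailBound N L σ2 τ = δ := by
  have h0 : tailBound N L σ2 0 = 2 := by simp [tailBound]
  obtain ⟨M, hM0, hM⟩ : ∃ M : ℝ, 0 < M ∧ tailBound N L σ2 M ≤ δ := by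
    refine ⟨max (σ2 / L * Real.exp 2) (L * Real.log (2 / δ)), by positivity, ?_⟩
    set M := max (σ2 / L * Real.exp 2) (L * Real.log (2 / δ))
    have hM0 : 0 < M := by positivity
    have h1 : Real.exp 2 ≤ M * L / σ2 := by
      have : σ2 / L * Real.exp 2 ≤ M := le_max_left _ _
      calc Real.exp 2 = σ2 / L * Real.exp 2 * L / σ2 := by field_simp
        _ ≤ M * L / σ2 := by gcongr
    have h2 : Real.log (2 / δ) ≤ M / L := by
      rw [le_div_iff₀ hL, mul_comm]; exact le_max_right _ _
    refine (tailBound_le hN hL hσ hM0.le ?_).trans ?_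
    · rw [Real.le_log_iff_exp_le (by positivity)]; linarith
    · calc 2 * Real.exp (-(M / L)) ≤ 2 * Real.exp (-Real.log (2 / δ)) := by gcongr
        _ = δ := by rw [Real.exp_neg, Real.exp_log (by positivity)]; field_simp
  have hivt := intermediate_value_Icc' hM0.le
    ((continuousOn_tailBound N hL hσ).mono Set.Icc_subset_Ici_self)
  obtain ⟨τ, hτ, hτδ⟩ := hivt ⟨hM, by rw [h0]; exact hδ1.le⟩
  refine ⟨τ, lt_of_le_of_ne hτ.1 ?_, hτδ⟩
  rintro rfl
  rw [h0] at hτδ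
  linarith

/-- Bernstein's choice of Chernoff's parameter, at the deviation
`τ = 2 L l / N + √(2 v l / N)`, beats `exp (-l)` by a factor depending on `r = L √(2 l / (N v))`. -/
theorem bernstein_exponent {N : ℕ} (hN : 0 < N) {L v l : ℝ} (hL : 0 < L) (hv : 0 < v) (hl : 0 < l)
    {r : ℝ} (hr : r = L * √(2 * (l / N) / v)) :
    ∃ s : ℝ, 0 ≤ s ∧
      2 * Real.exp (-(s * (N * (2 * L * l / N + √(l / N * (2 * v)))))) *
        (1 + v / L ^ 2 * (Real.exp (s * L) - 1 - s * L)) ^ N ≤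
      2 * Real.exp (-(l * (1 + 2 * r) / (1 + r / 3))) := by
  have hNr : (0 : ℝ) < N := by exact_mod_cast hN
  set x := l / N with hx
  have hx0 : 0 < x := by positivity
  have hlx : l = N * x := by rw [hx]; field_simp
  have hr0 : 0 < r := by rw [hr]; positivity
  have hr2 : r ^ 2 = L ^ 2 * (2 * x / v) := by
    rw [hr, mul_pow, Real.sq_sqrt (by positivity)]
  have hrs : r * √(x * (2 * v)) = 2 * x * L := by
    rw [hr, mul_assoc, ← Real.sqrt_mul (by positivity)]
    have : 2 * x / v * (x * (2 * v)) = (2 * x) ^ 2 := by field_simp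
    rw [this, Real.sqrt_sq (by positivity)]; ring
  set u := r / (1 + r / 3) with hu
  have hu0 : 0 < u := by positivity
  have hu3 : 1 - u / 3 = 1 / (1 + r / 3) := by rw [hu]; field_simp; ring
  have hu3' : u < 3 := by
    have : 0 < 1 - u / 3 := by rw [hu3]; positivity
    linarith
  refine ⟨u / L, by positivity, ?_⟩
  have hsL : u / L * L = u := by field_simp
  rw [hsL]
  have hψ : v / L ^ 2 * (Real.exp u - 1 - u) ≤ x / (1 + r / 3) := by
    calc v / L ^ 2 * (Real.exp u - 1 - u) ≤ v / L ^ 2 * (u ^ 2 / (2 * (1 - u / 3))) := by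
          gcongr; exact exp_sub_one_sub_le hu0.le hu3'
      _ = v / L ^ 2 * (r ^ 2 / (2 * (1 + r / 3))) := by rw [hu3, hu]; field_simp
      _ = x / (1 + r / 3) := by rw [hr2]; field_simp
  have hψ0 : 0 ≤ v / L ^ 2 * (Real.exp u - 1 - u) := by
    have := Real.add_one_le_exp u
    have h2 : 0 ≤ Real.exp u - 1 - u := by linarith
    positivity
  have hpow : (1 + v / L ^ 2 * (Real.exp u - 1 - u)) ^ N ≤ Real.exp (N * (x / (1 + r / 3))) := by
    rw [Real.exp_nat_mul]
    refine pow_le_pow_left₀ (by positivity) ?_ N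
    have := Real.add_one_le_exp (x / (1 + r / 3))
    linarith
  have hlin : u / L * (N * (2 * L * l / N + √(x * (2 * v)))) =
      N * x * (2 + 2 * r) / (1 + r / 3) := by
    have h1 : u / L * (N * (2 * L * l / N + √(x * (2 * v)))) =
        N * (2 * L * x * r + r * √(x * (2 * v))) / (L * (1 + r / 3)) := by
      rw [hu, hlx]; field_simp
    rw [h1, hrs]; field_simp; ring
  calc _ ≤ 2 * Real.exp (-(N * x * (2 + 2 * r) / (1 + r / 3))) *
        Real.exp (N * (x / (1 + r / 3))) := by rw [hlin]; gcongr
    _ = _ := by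
        rw [mul_assoc, ← Real.exp_add, hlx]
        congr 2; field_simp; ring

theorem exp_neg_add_exp_sq_lt_two {z : ℝ} (hz : 0 < z) (hz2 : z ^ 2 ≤ 1 / 2) :
    Real.exp (-(3 * z)) + Real.exp (z ^ 2) < 2 := by
  have h1 : Real.exp (z ^ 2) ≤ 1 + 3 / 2 * z ^ 2 := by
    have h := Real.abs_exp_sub_one_sub_id_le (x := z ^ 2) (by
      rw [abs_of_nonneg (sq_nonneg z)]; linarith)
    have h' := (abs_le.1 h).2
    nlinarith [sq_nonneg z]
  have hz1 : z < 3 / 4 := by nlinarith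
  have h2 : 1 + 3 * z + (3 * z) ^ 2 / 2 ≤ Real.exp (3 * z) :=
    Real.quadratic_le_exp_of_nonneg (by positivity)
  have h3 : Real.exp (-(3 * z)) < 1 - 3 / 2 * z ^ 2 := by
    have h4 : 0 < 1 - 3 / 2 * z ^ 2 := by linarith
    have h5 : 1 < (1 - 3 / 2 * z ^ 2) * (1 + 3 * z + (3 * z) ^ 2 / 2) := by
      nlinarith [mul_pos hz hz, mul_nonneg hz.le (sub_nonneg.2 hz2),
        mul_nonneg (mul_pos hz hz).le (sub_nonneg.2 hz2)]
    rw [Real.exp_neg, inv_lt_iff_one_lt_mul₀ (Real.exp_pos _)]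
    exact h5.trans_le (mul_le_mul_of_nonneg_left h2 h4.le)
  linarith

/-- The gain in Bernstein's bound pays for the exponent `N - 1 ≤ 2 ⌊N / 2⌋`, in place of `N`, of
Hoeffding's bound for U-statistics. -/
theorem two_exp_add_exp_lt {N : ℕ} {L v δ : ℝ} (hL : 0 < L) (hv : 0 < v)
    (hvL : 2 * v ≤ L ^ 2) (hδ0 : 0 < δ) (hδ : δ < 1 / 2)
    (hNl : 2 * Real.log (2 / δ) < N) {r : ℝ}
    (hr : r = L * √(2 * (Real.log (2 / δ) / N) / v)) :
    2 * Real.exp (-(Real.log (2 / δ) * (1 + 2 * r) / (1 + r / 3))) +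
      Real.exp (-((N - 1) * (Real.log (1 / δ) / N))) < 2 * δ := by
  set l := Real.log (2 / δ) with hl
  set m := Real.log (1 / δ) with hm
  have hlm : l = Real.log 2 + m := by
    rw [hl, hm, ← Real.log_mul (by norm_num) (by positivity)]
    congr 1; ring
  have hlog2 := Real.log_two_gt_d9
  have hmlog : Real.log 2 < m := by
    rw [hm]
    refine Real.log_lt_log (by norm_num) ?_
    rw [lt_div_iff₀ hδ0]; linarith
  have hl1 : 1.38 < l := by linarith
  have hNr : (0 : ℝ) < N := by linarith
  set z := √(l / N) with hz
  have hz0 : 0 < z := by positivity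
  have hzsq : z ^ 2 = l / N := Real.sq_sqrt (by positivity)
  have hz2 : z ^ 2 ≤ 1 / 2 := by
    rw [hzsq, div_le_iff₀ hNr]; linarith
  have hz1 : z < 3 / 4 := by nlinarith
  have hrz : 2 * z ≤ r := by
    refine (pow_le_pow_iff_left₀ (by positivity) (by rw [hr]; positivity) two_ne_zero).1 ?_
    rw [hr]
    rw [mul_pow, mul_pow, hzsq, Real.sq_sqrt (by positivity)]
    have : 2 ≤ L ^ 2 / v := by rw [le_div_iff₀ hv]; exact hvL
    calc 2 ^ 2 * (l / N) = 2 * (l / N) * 2 := by ring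
      _ ≤ 2 * (l / N) * (L ^ 2 / v) := by gcongr
      _ = L ^ 2 * (2 * (l / N) / v) := by ring
  have hr0 : 0 < r := by linarith
  have hE : l + 3 * z ≤ l * (1 + 2 * r) / (1 + r / 3) := by
    rw [le_div_iff₀ (by positivity)]
    nlinarith [mul_pos hz0 hr0, mul_le_mul_of_nonneg_left hrz (by linarith : (0:ℝ) ≤ l)]
  have h1 : 2 * Real.exp (-(l * (1 + 2 * r) / (1 + r / 3))) ≤ δ * Real.exp (-(3 * z)) := by
    calc 2 * Real.exp (-(l * (1 + 2 * r) / (1 + r / 3)))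
        ≤ 2 * Real.exp (-(l + 3 * z)) := by gcongr
      _ = δ * Real.exp (-(3 * z)) := by
        rw [neg_add, Real.exp_add, Real.exp_neg l, hl, Real.exp_log (by positivity)]
        field_simp
  have h2 : Real.exp (-((N - 1) * (m / N))) ≤ δ * Real.exp (z ^ 2) := by
    have : -((N - 1) * (m / N)) = -m + m / N := by field_simp; ring
    rw [this, Real.exp_add, Real.exp_neg, hm, Real.exp_log (by positivity), ← hm, hzsq]
    simp only [one_div, inv_inv]
    gcongr
    linarith
  have h3 := mul_lt_mul_of_pos_left (exp_neg_add_exp_sq_lt_two hz0 hz2) hδ0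
  linarith

end RealInequalities

/-! ### Concentration of the mean of a bounded sample in a Hilbert space -/

section SampleMean

theorem norm_le_of_diam {E G : Type*} [NormedAddCommGroup G] {ψ : E → G} {L : ℝ}
    (hd : ∀ x y, ‖ψ x - ψ y‖ ≤ L) (x₀ x : E) : ‖ψ x‖ ≤ ‖ψ x₀‖ + L := by
  have := norm_le_insert' (ψ x) (ψ x₀)
  linarith [hd x x₀]

theorem norm_average_sub_eq {G : Type*} [NormedAddCommGroup G] [InnerProductSpace ℝ G] {N : ℕ}
    (hN : 0 < N) (y : Fin N → G) (m : G) :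
    ‖(N : ℝ)⁻¹ • ∑ i, y i - m‖ = (N : ℝ)⁻¹ * ‖∑ i, (y i - m)‖ := by
  have hNr : (N : ℝ) ≠ 0 := by positivity
  rw [← Real.norm_of_nonneg (by positivity : 0 ≤ (N : ℝ)⁻¹), ← norm_smul, norm_inv,
    Real.norm_natCast, Finset.sum_sub_distrib, smul_sub]
  simp [← Nat.cast_smul_eq_nsmul ℝ, smul_smul, hNr]

variable {E : Type*} [MeasurableSpace E] {μ : Measure E} [IsProbabilityMeasure μ]
  {G : Type*} [NormedAddCommGroup G]
  [SecondCountableTopology G] [MeasurableSpace G] [BorelSpace G] {ψ : E → G} {L : ℝ}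

theorem integrable_of_diam (hψ : Measurable ψ) (hd : ∀ x y, ‖ψ x - ψ y‖ ≤ L) :
    Integrable ψ μ := by
  obtain ⟨x₀⟩ := nonempty_of_isProbabilityMeasure μ
  exact .of_bound hψ.aestronglyMeasurable _ (.of_forall (norm_le_of_diam hd x₀))

theorem integrable_norm_sub_sq (hψ : Measurable ψ) (hd : ∀ x y, ‖ψ x - ψ y‖ ≤ L) (c : G) :
    Integrable (fun x => ‖ψ x - c‖ ^ 2) μ := by
  obtain ⟨x₀⟩ := nonempty_of_isProbabilityMeasure μ
  refine .of_bound (by fun_prop) ((‖ψ x₀‖ + L + ‖c‖) ^ 2) (.of_forall fun x => ?_)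
  rw [norm_pow, norm_norm]
  gcongr
  exact (norm_sub_le _ _).trans (by gcongr; exact norm_le_of_diam hd x₀ x)

variable [InnerProductSpace ℝ G]

theorem variance_pos [MeasurableSingletonClass E] [NullSingletonClass μ] (hψ : Measurable ψ)
    (hd : ∀ x y, ‖ψ x - ψ y‖ ≤ L) (hinj : Function.Injective ψ) :
    0 < ∫ x, ‖ψ x - ∫ y, ψ y ∂μ‖ ^ 2 ∂μ := by
  refine (integral_nonneg fun x => by positivity).lt_of_ne fun h0 => ?_
  rw [eq_comm, integral_eq_zero_iff_of_nonneg (fun x => by positivity)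
    (integrable_norm_sub_sq hψ hd _)] at h0
  have hsub : {x | ψ x = ∫ y, ψ y ∂μ}.Subsingleton := fun a ha b hb =>
    hinj (Eq.trans ha (Eq.symm hb))
  have hnull : ∀ᵐ x ∂μ, x ∉ {x | ψ x = ∫ y, ψ y ∂μ} :=
    measure_eq_zero_iff_ae_notMem.1 (hsub.measure_zero μ)
  have hfalse : ∀ᵐ _ ∂μ, False := by
    filter_upwards [h0, hnull] with x h1 h2
    exact h2 (by simpa [sub_eq_zero] using h1)
  exact hfalse.exists.elim fun _ h => h

variable [CompleteSpace G]

theorem norm_sub_integral_le (hψ : Measurable ψ) (hd : ∀ x y, ‖ψ x - ψ y‖ ≤ L) (x : E) :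
    ‖ψ x - ∫ y, ψ y ∂μ‖ ≤ L := by
  have hi : Integrable ψ μ := integrable_of_diam hψ hd
  have h : ψ x - ∫ y, ψ y ∂μ = ∫ y, (ψ x - ψ y) ∂μ := by
    rw [integral_sub (integrable_const _) hi]; simp
  rw [h]
  have := norm_integral_le_of_norm_le_const (μ := μ) (.of_forall fun y => hd x y)
  simpa using this

theorem integral_norm_sub_sq (hψ : Measurable ψ) (hd : ∀ x y, ‖ψ x - ψ y‖ ≤ L) (c : G) :
    ∫ x, ‖ψ x - c‖ ^ 2 ∂μ =
      ∫ x, ‖ψ x - ∫ y, ψ y ∂μ‖ ^ 2 ∂μ + ‖∫ y, ψ y ∂μ - c‖ ^ 2 := by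
  have hi : Integrable ψ μ := integrable_of_diam hψ hd
  set m := ∫ y, ψ y ∂μ with hm
  have hexp : ∀ x, ‖ψ x - c‖ ^ 2 = ‖ψ x - m‖ ^ 2 + 2 * inner ℝ (m - c) (ψ x - m) +
      ‖m - c‖ ^ 2 := by
    intro x
    rw [← sub_add_sub_cancel (ψ x) m c, norm_add_sq_real, real_inner_comm]
  have hsub : Integrable (fun x => ψ x - m) μ := hi.sub (integrable_const _)
  have hin : Integrable (fun x => 2 * inner ℝ (m - c) (ψ x - m)) μ :=
    (hsub.const_inner _).const_mul 2
  have hsq := integrable_norm_sub_sq (μ := μ) hψ hd m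
  simp only [hexp]
  have hadd : Integrable (fun x => ‖ψ x - m‖ ^ 2 + 2 * inner ℝ (m - c) (ψ x - m)) μ :=
    hsq.add hin
  rw [integral_add hadd (integrable_const _), integral_add hsq hin,
    integral_const_mul, integral_inner hsub, integral_sub hi (integrable_const _)]
  simp [← hm]

/-- The variance is half the mean square distance of two independent copies. -/
theorem integral_prod_norm_sub_sq (hψ : Measurable ψ) (hd : ∀ x y, ‖ψ x - ψ y‖ ≤ L) :
    ∫ p : E × E, ‖ψ p.1 - ψ p.2‖ ^ 2 ∂(μ.prod μ) =
      2 * ∫ x, ‖ψ x - ∫ y, ψ y ∂μ‖ ^ 2 ∂μ := by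
  set m := ∫ y, ψ y ∂μ with hm
  have hint : Integrable (fun p : E × E => ‖ψ p.1 - ψ p.2‖ ^ 2) (μ.prod μ) := by
    refine .of_bound (by fun_prop) (L ^ 2) (.of_forall fun p => ?_)
    rw [norm_pow, norm_norm]
    exact pow_le_pow_left₀ (norm_nonneg _) (hd _ _) 2
  rw [integral_prod _ hint]
  have hin : ∀ x, ∫ y, ‖ψ x - ψ y‖ ^ 2 ∂μ = ∫ y, ‖ψ y - m‖ ^ 2 ∂μ + ‖ψ x - m‖ ^ 2 := by
    intro x
    simp only [norm_sub_rev (ψ x) _]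
    rw [integral_norm_sub_sq hψ hd (ψ x), ← hm]
  simp only [hin]
  rw [integral_add (integrable_const _) (integrable_norm_sub_sq hψ hd m), integral_const,
    probReal_univ, one_smul]
  ring

variable {Ω : Type*} [MeasurableSpace Ω] {P : Measure Ω} [IsProbabilityMeasure P]
  {N : ℕ} {X : Fin N → Ω → E}

theorem measure_lt_norm_average_le (hψ : Measurable ψ) (hd : ∀ x y, ‖ψ x - ψ y‖ ≤ L)
    (hL : 0 < L) (hN : 0 < N) (hX : ∀ i, Measurable (X i)) (hind : iIndepFun X P)
    (hlaw : ∀ i, P.map (X i) = μ) {v : ℝ} (hv : ∫ x, ‖ψ x - ∫ y, ψ y ∂μ‖ ^ 2 ∂μ ≤ v)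
    {s τ : ℝ} (hs : 0 ≤ s) (hτ : 0 ≤ τ) :
    P.real {ω | τ < ‖(N : ℝ)⁻¹ • ∑ i, ψ (X i ω) - ∫ y, ψ y ∂μ‖} ≤
      2 * Real.exp (-(s * (N * τ))) *
        (1 + v / L ^ 2 * (Real.exp (s * L) - 1 - s * L)) ^ N := by
  have hNr : (0 : ℝ) < N := by exact_mod_cast hN
  set m := ∫ y, ψ y ∂μ with hm
  have hset : {ω | τ < ‖(N : ℝ)⁻¹ • ∑ i, ψ (X i ω) - m‖} =
      {ω | N * τ < ‖∑ i, (ψ (X i ω) - m)‖} := by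
    ext ω
    simp only [Set.mem_ofPred_eq]
    rw [norm_average_sub_eq hN, inv_mul_eq_div, lt_div_iff₀ hNr, mul_comm]
  rw [hset]
  have hφ : Measurable fun x => ψ x - m := hψ.sub_const m
  refine measure_lt_norm_sum_le (ξ := fun i ω => ψ (X i ω) - m) (fun i => hφ.comp (hX i))
    (hind.comp (fun _ x => ψ x - m) fun _ => hφ) hL
    (fun i ω => norm_sub_integral_le hψ hd _) (fun i => ?_) (fun i => ?_) hs (by positivity)
  · rw [← integral_map (hX i).aemeasurable (f := fun x => ψ x - m) hφ.aestronglyMeasurable, hlaw,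
      integral_sub (integrable_of_diam hψ hd) (integrable_const _)]
    simp [hm]
  · rw [← integral_map (hX i).aemeasurable (f := fun x => ‖ψ x - m‖ ^ 2)
      (by fun_prop), hlaw]
    exact hv

/-- The lower tail of the U-statistic that estimates twice the variance. -/
theorem measure_uStatistic_le (hψ : Measurable ψ) (hd : ∀ x y, ‖ψ x - ψ y‖ ≤ L)
    (hL : 0 < L) (hN : 2 ≤ N) (hX : ∀ i, Measurable (X i)) (hind : iIndepFun X P)
    (hlaw : ∀ i, P.map (X i) = μ) {y : ℝ} (hy : 0 ≤ y) :
    P.real {ω | 1 / ((N : ℝ) * ((N : ℝ) - 1)) * ∑ p ∈ (Finset.univ : Finset (Fin N)).offDiag,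
        ‖ψ (X p.1 ω) - ψ (X p.2 ω)‖ ^ 2 + L ^ 2 * √y ≤
          2 * ∫ x, ‖ψ x - ∫ y, ψ y ∂μ‖ ^ 2 ∂μ} ≤ Real.exp (-((N - 1) * y)) := by
  have h := (hasSubgaussianMGF_uStatistic hN hX hind hlaw
    (g := fun p : E × E => ‖ψ p.1 - ψ p.2‖ ^ 2) (by fun_prop) (B := L ^ 2)
    fun p => ⟨by positivity, pow_le_pow_left₀ (norm_nonneg _) (hd _ _) 2⟩).neg
  rw [integral_prod_norm_sub_sq hψ hd] at h
  have hk : (N - 1 : ℝ) ≤ 2 * ((N / 2 : ℕ) : ℝ) := by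
    have : N ≤ 2 * (N / 2) + 1 := by omega
    have : (N : ℝ) ≤ 2 * ((N / 2 : ℕ) : ℝ) + 1 := by exact_mod_cast this
    linarith
  have hk0 : (0 : ℝ) < ((N / 2 : ℕ) : ℝ) := by
    have : 0 < N / 2 := by omega
    exact_mod_cast this
  refine le_trans (measureReal_mono (fun ω hω => ?_) (measure_ne_top _ _))
    ((h.measure_ge_le (ε := L ^ 2 * √y) (by positivity)).trans (Real.exp_le_exp.2 ?_))
  · simp only [Set.mem_ofPred_eq, Pi.neg_apply] at hω ⊢
    linarith
  · have : -(L ^ 2 * √y) ^ 2 / (2 * (((((N / 2 : ℕ) : NNReal)⁻¹ * (‖L ^ 2 - 0‖₊ / 2) ^ 2 :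
        NNReal)) : ℝ)) = -(2 * ((N / 2 : ℕ) : ℝ) * y) := by
      push_cast
      rw [mul_pow, Real.sq_sqrt hy, sub_zero,
        Real.norm_of_nonneg (sq_nonneg L)]
      field_simp
    rw [this]
    have := mul_le_mul_of_nonneg_right hk hy
    linarith

/-- The empirical Bernstein bound: on the complement of the two exceptional events the data-driven
threshold exceeds Bernstein's threshold with the true variance. -/
theorem measure_empirical_bernstein_lt (hψ : Measurable ψ) (hd : ∀ x y, ‖ψ x - ψ y‖ ≤ L)
    (hL : 0 < L) (hN : 2 ≤ N) (hX : ∀ i, Measurable (X i)) (hind : iIndepFun X P)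
    (hlaw : ∀ i, P.map (X i) = μ) (hv : 0 < ∫ x, ‖ψ x - ∫ y, ψ y ∂μ‖ ^ 2 ∂μ)
    {δ : ℝ} (hδ0 : 0 < δ) (hδ : δ < 1 / 2) :
    P.real {ω | 2 * L * Real.log (2 / δ) / N + √(Real.log (2 / δ) / N *
        (1 / ((N : ℝ) * ((N : ℝ) - 1)) * ∑ p ∈ (Finset.univ : Finset (Fin N)).offDiag,
          ‖ψ (X p.1 ω) - ψ (X p.2 ω)‖ ^ 2 + L ^ 2 * √(Real.log (1 / δ) / N))) <
      ‖(N : ℝ)⁻¹ • ∑ i, ψ (X i ω) - ∫ y, ψ y ∂μ‖} < 2 * δ := by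
  have hNr : (0 : ℝ) < N := by positivity
  have hl0 : 0 < Real.log (2 / δ) := Real.log_pos (by rw [lt_div_iff₀ hδ0]; linarith)
  have hm0 : 0 < Real.log (1 / δ) := Real.log_pos (by rw [lt_div_iff₀ hδ0]; linarith)
  rcases le_or_gt (N : ℝ) (2 * Real.log (2 / δ)) with hsmall | hbig
  · -- the first term of the threshold already exceeds the diameter `L`
    convert (by positivity : 0 < 2 * δ)
    rw [measureReal_eq_zero_iff]
    convert measure_empty (μ := P)
    rw [Set.eq_empty_iff_forall_notMem]
    intro ω hω
    have h1 : ‖(N : ℝ)⁻¹ • ∑ i, ψ (X i ω) - ∫ y, ψ y ∂μ‖ ≤ L := by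
      rw [norm_average_sub_eq (by omega), inv_mul_le_iff₀ hNr]
      refine (norm_sum_le_of_le _ fun i _ => norm_sub_integral_le hψ hd _).trans (by simp)
    have h2 : L ≤ 2 * L * Real.log (2 / δ) / N := by
      rw [le_div_iff₀ hNr]; nlinarith
    have h3 := Real.sqrt_nonneg (Real.log (2 / δ) / N *
        (1 / ((N : ℝ) * ((N : ℝ) - 1)) * ∑ p ∈ (Finset.univ : Finset (Fin N)).offDiag,
          ‖ψ (X p.1 ω) - ψ (X p.2 ω)‖ ^ 2 + L ^ 2 * √(Real.log (1 / δ) / N)))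
    simp only [Set.mem_ofPred_eq] at hω
    linarith
  set v := ∫ x, ‖ψ x - ∫ y, ψ y ∂μ‖ ^ 2 ∂μ with hvdef
  have hvL : 2 * v ≤ L ^ 2 := by
    rw [hvdef, ← integral_prod_norm_sub_sq hψ hd]
    refine (integral_mono_of_nonneg (.of_forall fun p => by positivity) (integrable_const (L ^ 2))
      (.of_forall fun p => pow_le_pow_left₀ (norm_nonneg _) (hd _ _) 2)).trans (by simp)
  obtain ⟨s, hs, hbern⟩ := bernstein_exponent (N := N) (by omega) hL hv hl0 rfl
  have hA := measure_lt_norm_average_le (P := P) hψ hd hL (by omega) hX hind hlaw hvdef.ge hs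
    (τ := 2 * L * Real.log (2 / δ) / N + √(Real.log (2 / δ) / N * (2 * v))) (by positivity)
  have hB := measure_uStatistic_le (P := P) hψ hd hL hN hX hind hlaw
    (y := Real.log (1 / δ) / N) (by positivity)
  refine lt_of_le_of_lt ?_ (two_exp_add_exp_lt hL hv hvL hδ0 hδ hbig rfl)
  refine le_trans ?_ (add_le_add (hA.trans hbern) hB)
  refine le_trans (measureReal_mono (fun ω hω => ?_) (measure_ne_top _ _))
    (measureReal_union_le _ _)
  simp only [Set.mem_ofPred_eq, Set.mem_union] at hω ⊢
  by_contra! hcon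
  refine absurd hω (not_lt.2 (hcon.1.trans ?_))
  gcongr
  exact hcon.2.le

end SampleMean

/-! ### The Hilbert-Schmidt norm of an integral operator -/

section KernelNorm

instance fact_two_ne_top : Fact ((2 : ℝ≥0∞) ≠ ∞) := ⟨by norm_num⟩

theorem countable_of_hilbertBasis {H : Type*} [NormedAddCommGroup H] [InnerProductSpace ℝ H]
    [TopologicalSpace.SeparableSpace H] {ι : Type*} (e : HilbertBasis ι ℝ H) : Countable ι := by
  have hdisj : Pairwise (Function.onFun Disjoint fun i => Metric.ball (e i) (1 / 2)) := by
    intro i j hij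
    refine Metric.ball_disjoint_ball ?_
    have hsq : ‖e i - e j‖ ^ 2 = 2 := by
      rw [norm_sub_sq_real, e.orthonormal.2 hij, e.orthonormal.1, e.orthonormal.1]
      norm_num
    rw [dist_eq_norm]
    nlinarith [norm_nonneg (e i - e j)]
  exact hdisj.countable_of_isOpen_disjoint (fun _ => Metric.isOpen_ball)
    fun i => ⟨e i, Metric.mem_ball_self (by norm_num)⟩

/-- The Hilbert-Schmidt norm of an integral operator is the `L²` norm of its kernel: Parseval's
identity on almost every slice of the kernel, and Tonelli's theorem. -/
theorem hsSum_integralOp {k : ℝ × ℝ → ℝ} (hk : MemLp k 2 volume) {ι : Type*}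
    (e : HilbertBasis ι ℝ L2R) : hsSum e (integralOp k) = eLpNorm k 2 volume ^ 2 := by
  have : Countable ι := countable_of_hilbertBasis e
  have hterm : ∀ i, ∑' j, ENNReal.ofReal ((inner ℝ (e j) (integralOp k (e i))) ^ 2) =
      ∫⁻ x₂, ‖∫ x₁, e i x₁ * k (x₁, x₂)‖ₑ ^ 2 := by
    intro i
    rw [tsum_ofReal_inner_sq, ENNReal.ofReal_pow (norm_nonneg _), ofReal_norm,
      Lp.enorm_def, eLpNorm_two_sq]
    refine lintegral_congr_ae ?_
    filter_upwards [integralOp_apply hk (e i)] with x₂ hx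
    rw [hx]
  unfold hsSum
  simp only [hterm]
  rw [← lintegral_tsum fun i => (kernel_integral_spec hk (e i)).2.1.enorm.pow_const 2]
  have hkm : AEStronglyMeasurable k ((volume : Measure ℝ).prod volume) := hk.1
  have hfin := eLpNorm_two_sq ((volume : Measure ℝ).prod volume) k
  rw [lintegral_prod_symm _ (hkm.enorm.pow_const 2)] at hfin
  refine Eq.trans (lintegral_congr_ae ?_) hfin.symm
  filter_upwards [ae_memLp_slice hk] with x₂ hx
  have hin : ∀ i, ∫ x₁, e i x₁ * k (x₁, x₂) = inner ℝ (e i) hx.toLp := by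
    intro i
    rw [L2.inner_def]
    refine integral_congr_ae ?_
    filter_upwards [hx.coeFn_toLp] with x₁ h
    rw [h, real_inner_eq_re_inner, RCLike.inner_apply]
    simp [mul_comm]
  have hen : ∀ i, ‖∫ x₁, e i x₁ * k (x₁, x₂)‖ₑ ^ 2 =
      ENNReal.ofReal ((inner ℝ (e i) hx.toLp) ^ 2) := by
    intro i
    rw [hin, ← sq_abs, ENNReal.ofReal_pow (abs_nonneg _), ← Real.norm_eq_abs,
      ofReal_norm]
  simp only [hen]
  rw [tsum_ofReal_inner_sq, ENNReal.ofReal_pow (norm_nonneg _), ofReal_norm,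
    Lp.enorm_toLp, eLpNorm_two_sq]

theorem isHilbertSchmidt_integralOp {k : ℝ × ℝ → ℝ} (hk : MemLp k 2 volume) :
    IsHilbertSchmidt (integralOp k) := by
  rw [IsHilbertSchmidt, hsSum_integralOp hk]
  exact ENNReal.pow_ne_top hk.2.ne

theorem hsNorm_integralOp {k : ℝ × ℝ → ℝ} (hk : MemLp k 2 volume) :
    hsNorm (integralOp k) = ‖hk.toLp‖ := by
  rw [hsNorm, hsSum_integralOp hk, ENNReal.toReal_pow, Real.sqrt_sq ENNReal.toReal_nonneg,
    Lp.norm_toLp]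

theorem integralOp_sub {k k' : ℝ × ℝ → ℝ} (hk : MemLp k 2 volume) (hk' : MemLp k' 2 volume) :
    integralOp k - integralOp k' = integralOp (k - k') := by
  refine ContinuousLinearMap.ext fun u => Lp.ext ?_
  rw [sub_apply]
  filter_upwards [Lp.coeFn_sub (integralOp k u) (integralOp k' u), integralOp_apply hk u,
    integralOp_apply hk' u, integralOp_apply (hk.sub hk') u, (kernel_integral_spec hk u).1,
    (kernel_integral_spec hk' u).1] with x₂ h1 h2 h3 h4 h5 h6
  rw [h1, Pi.sub_apply, h2, h3, h4, ← integral_sub h5 h6]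
  simp only [Pi.sub_apply, mul_sub]

theorem hsNorm_integralOp_sub {k k' : ℝ × ℝ → ℝ} (hk : MemLp k 2 volume)
    (hk' : MemLp k' 2 volume) :
    hsNorm (integralOp k - integralOp k') = ‖hk.toLp - hk'.toLp‖ := by
  rw [integralOp_sub hk hk', hsNorm_integralOp (hk.sub hk'), MemLp.toLp_sub]

theorem memLp_tensor {k₁ k₂ : ℝ → ℝ} (h₁ : MemLp k₁ 2 volume) (h₂ : MemLp k₂ 2 volume) :
    MemLp (fun y : ℝ × ℝ => k₁ y.1 * k₂ y.2) 2 volume := by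
  have hm : AEStronglyMeasurable (fun y : ℝ × ℝ => k₁ y.1 * k₂ y.2)
      ((volume : Measure ℝ).prod volume) := h₁.1.comp_fst.mul h₂.1.comp_snd
  refine ⟨hm, ?_⟩
  suffices h : eLpNorm (fun y : ℝ × ℝ => k₁ y.1 * k₂ y.2) 2 volume ^ 2 < ∞ from
    (ENNReal.pow_lt_top_iff.1 h).resolve_right two_ne_zero
  rw [eLpNorm_two_sq]
  simp only [enorm_mul, mul_pow]
  have := lintegral_prod_mul (μ := (volume : Measure ℝ)) (ν := (volume : Measure ℝ))
    (f := fun x => ‖k₁ x‖ₑ ^ 2) (g := fun x => ‖k₂ x‖ₑ ^ 2) (h₁.1.enorm.pow_const 2)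
    (h₂.1.enorm.pow_const 2)
  rw [Measure.volume_eq_prod, this, ← eLpNorm_two_sq, ← eLpNorm_two_sq]
  exact ENNReal.mul_lt_top (ENNReal.pow_lt_top h₁.2) (ENNReal.pow_lt_top h₂.2)

theorem rankOne_toL2_eq_integralOp {k₁ k₂ : ℝ → ℝ} (h₁ : MemLp k₁ 2 volume)
    (h₂ : MemLp k₂ 2 volume) :
    InnerProductSpace.rankOne ℝ (toL2 k₂) (toL2 k₁) =
      integralOp fun y : ℝ × ℝ => k₁ y.1 * k₂ y.2 := by
  refine ContinuousLinearMap.ext fun u => Lp.ext ?_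
  rw [InnerProductSpace.rankOne_apply]
  filter_upwards [Lp.coeFn_smul (inner ℝ (toL2 k₁) u) (toL2 k₂), toL2_coe h₂,
    integralOp_apply (memLp_tensor h₁ h₂) u] with x₂ h3 h4 h5
  rw [h3, Pi.smul_apply, h4, h5, smul_eq_mul, L2.inner_def, ← integral_mul_const]
  refine integral_congr_ae ?_
  filter_upwards [toL2_coe h₁] with x₁ h
  rw [h, RCLike.inner_apply]
  simp only [conj_trivial]
  ring

end KernelNorm

/-! ### Translates of square integrable functions -/

section Translation

/-- The real Hilbert space `L²(ℝ²)` of Hilbert-Schmidt kernels. -/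
abbrev L2Plane : Type := Lp ℝ 2 (volume : Measure (ℝ × ℝ))

theorem memLp_translate {T : ℝ × ℝ → ℝ} (hT : MemLp T 2 volume) (p : ℝ × ℝ) :
    MemLp (fun y => T (y - p)) 2 volume :=
  hT.comp_measurePreserving (measurePreserving_sub_right volume p)

theorem memLp_reflect {T : ℝ × ℝ → ℝ} (hT : MemLp T 2 volume) (p : ℝ × ℝ) :
    MemLp (fun y => T (p - y)) 2 volume :=
  hT.comp_measurePreserving (Measure.measurePreserving_sub_left volume p)

/-- The translate `T(· - p)` of a square integrable function on the plane, as a vector of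
`L²(ℝ²)`. -/
noncomputable def translateLp {T : ℝ × ℝ → ℝ} (hT : MemLp T 2 volume) (p : ℝ × ℝ) : L2Plane :=
  (memLp_translate hT p).toLp

theorem translateLp_eq_vadd {T : ℝ × ℝ → ℝ} (hT : MemLp T 2 volume) (p : ℝ × ℝ) :
    translateLp hT p = DomAddAct.mk (-p) +ᵥ hT.toLp := by
  rw [DomAddAct.mk_vadd_toLp]
  exact MemLp.toLp_congr _ _ (.of_forall fun y => by
    simp only [vadd_eq_add]
    rw [neg_add_eq_sub])

theorem continuous_translateLp {T : ℝ × ℝ → ℝ} (hT : MemLp T 2 volume) :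
    Continuous (translateLp hT) := by
  have : translateLp hT = fun p : ℝ × ℝ => DomAddAct.mk (-p) +ᵥ hT.toLp :=
    funext (translateLp_eq_vadd hT)
  rw [this]
  have h : Continuous fun p : ℝ × ℝ => DomAddAct.mk (-p) :=
    DomAddAct.continuous_mk.comp continuous_neg
  exact h.vadd continuous_const

theorem norm_translateLp {T : ℝ × ℝ → ℝ} (hT : MemLp T 2 volume) (p : ℝ × ℝ) :
    ‖translateLp hT p‖ = ‖hT.toLp‖ := by
  rw [translateLp_eq_vadd, DomAddAct.norm_vadd_Lp]

theorem norm_translateLp_sub_le {T : ℝ × ℝ → ℝ} (hT : MemLp T 2 volume) (p q : ℝ × ℝ) :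
    ‖translateLp hT p - translateLp hT q‖ ≤ 2 * ‖hT.toLp‖ := by
  refine (norm_sub_le _ _).trans ?_
  rw [norm_translateLp, norm_translateLp, two_mul]

/-- Reflecting the function does not change the distance of two of its translates, because
`y ↦ p + q - y` preserves the Lebesgue measure. -/
theorem norm_reflect_sub {T : ℝ × ℝ → ℝ} (hT : MemLp T 2 volume) (p q : ℝ × ℝ) :
    ‖(memLp_reflect hT p).toLp - (memLp_reflect hT q).toLp‖ =
      ‖translateLp hT p - translateLp hT q‖ := by
  rw [norm_sub_rev, translateLp, translateLp, ← MemLp.toLp_sub, ← MemLp.toLp_sub, Lp.norm_toLp,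
    Lp.norm_toLp]
  congr 1
  rw [← eLpNorm_comp_measurePreserving
    ((memLp_reflect hT q).sub (memLp_reflect hT p)).1
    (Measure.measurePreserving_sub_left volume (p + q))]
  congr 1
  funext y
  simp only [Function.comp_apply, Pi.sub_apply]
  congr 2 <;> abel

/-- A square integrable function with a nonzero period vanishes: its square is the density of a
finite invariant measure of the translation, which by Poincaré recurrence is zero since all
orbits escape to infinity. -/
theorem ae_eq_zero_of_translate_ae_eq {T : ℝ × ℝ → ℝ} (hT : MemLp T 2 volume) {d : ℝ × ℝ}
    (hd : d ≠ 0) (h : (fun y => T (y + d)) =ᵐ[volume] T) : T =ᵐ[volume] 0 := by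
  set ν : Measure (ℝ × ℝ) := volume.withDensity fun y => ‖T y‖ₑ ^ 2 with hν
  have hfin : ∫⁻ y, ‖T y‖ₑ ^ 2 ≠ ∞ := by
    rw [← eLpNorm_two_sq]
    exact ENNReal.pow_ne_top hT.2.ne
  have : IsFiniteMeasure ν := isFiniteMeasure_withDensity hfin
  have hmp : MeasurePreserving (fun y => y + d) ν ν := by
    refine ⟨measurable_add_const d, Measure.ext fun s hs => ?_⟩
    rw [Measure.map_apply (measurable_add_const d) hs, hν,
      withDensity_apply _ (measurable_add_const d hs), withDensity_apply _ hs,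
      ← (measurePreserving_add_right volume d).setLIntegral_comp_preimage_emb
        (MeasurableEquiv.addRight d).measurableEmbedding (fun y => ‖T y‖ₑ ^ 2) s]
    refine lintegral_congr_ae (ae_restrict_of_ae ?_)
    filter_upwards [h] with y hy
    rw [hy]
  have hball : ∀ R : ℕ, ∀ᵐ y ∂ν, y ∉ Metric.ball (0 : ℝ × ℝ) R := by
    intro R
    filter_upwards [hmp.conservative.ae_mem_imp_frequently_image_mem
      (Metric.isOpen_ball (x := (0 : ℝ × ℝ)) (ε := R)).nullMeasurableSet] with y hy hyR
    refine hy hyR ?_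
    have hlim : Filter.Tendsto (fun n : ℕ => (n : ℝ) * ‖d‖) Filter.atTop Filter.atTop :=
      tendsto_natCast_atTop_atTop.atTop_mul_const (norm_pos_iff.2 hd)
    filter_upwards [hlim.eventually_ge_atTop (R + ‖y‖)] with n hn hmem
    rw [add_right_iterate, mem_ball_zero_iff] at hmem
    have h1 : ‖n • d‖ ≤ ‖y + n • d‖ + ‖y‖ := by
      calc ‖n • d‖ = ‖y + n • d - y‖ := by rw [add_sub_cancel_left]
        _ ≤ _ := norm_sub_le _ _
    rw [← Nat.cast_smul_eq_nsmul ℝ, norm_smul, Real.norm_natCast] at h1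
    rw [← Nat.cast_smul_eq_nsmul ℝ] at hmem
    linarith
  have hfalse : ∀ᵐ _ ∂ν, False := by
    filter_upwards [ae_all_iff.2 hball] with y hy
    obtain ⟨R, hR⟩ := exists_nat_gt ‖y‖
    exact hy R (by simpa using hR)
  have hzero : ν = 0 := by
    simpa [Filter.eventually_false_iff_eq_bot] using hfalse
  rw [hν, withDensity_eq_zero_iff (hT.1.enorm.pow_const 2)] at hzero
  filter_upwards [hzero] with y hy
  simpa using hy

theorem injective_translateLp {T : ℝ × ℝ → ℝ} (hT : MemLp T 2 volume)
    (hT0 : ¬ T =ᵐ[volume] 0) : Function.Injective (translateLp hT) := by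
  intro p q hpq
  by_contra hne
  refine hT0 (ae_eq_zero_of_translate_ae_eq hT (d := p - q) (sub_ne_zero.2 hne) ?_)
  have h : (fun y => T (y - p)) =ᵐ[volume] fun y => T (y - q) :=
    (MemLp.toLp_eq_toLp_iff _ _).1 hpq
  have h2 := (measurePreserving_add_right volume p).quasiMeasurePreserving.ae_eq_comp h
  filter_upwards [h2] with y hy
  simp only [Function.comp_apply, add_sub_cancel_right] at hy
  rw [hy, add_sub_assoc]

variable {μ : Measure (ℝ × ℝ)}

theorem aestronglyMeasurable_translate {T : ℝ × ℝ → ℝ} (hT : MemLp T 2 volume)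
    (hμ : μ ≪ volume) :
    AEStronglyMeasurable (fun q : (ℝ × ℝ) × (ℝ × ℝ) => T (q.2 - q.1)) (μ.prod volume) := by
  have hq := (quasiMeasurePreserving_sub (volume : Measure (ℝ × ℝ)) volume).comp
    (Measure.measurePreserving_swap (μ := (volume : Measure (ℝ × ℝ)))
      (ν := (volume : Measure (ℝ × ℝ)))).quasiMeasurePreserving
  exact (hT.1.comp_quasiMeasurePreserving hq).mono_ac
    (hμ.prod Measure.AbsolutelyContinuous.rfl)

variable [IsProbabilityMeasure μ]

/-- By Jensen's inequality, the convolution of a square integrable function with a probability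
measure is square integrable. -/
theorem memLp_convolution {T : ℝ × ℝ → ℝ} (hT : MemLp T 2 volume) (hμ : μ ≪ volume) :
    MemLp (fun y => ∫ p, T (y - p) ∂μ) 2 volume := by
  have hm := aestronglyMeasurable_translate hT hμ
  refine ⟨hm.prod_swap.integral_prod_right', ?_⟩
  suffices h : eLpNorm (fun y => ∫ p, T (y - p) ∂μ) 2 volume ^ 2 < ∞ from
    (ENNReal.pow_lt_top_iff.1 h).resolve_right two_ne_zero
  have hslice : ∀ᵐ y : ℝ × ℝ, AEStronglyMeasurable (fun p => T (y - p)) μ :=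
    hm.prod_swap.prodMk_left
  rw [eLpNorm_two_sq]
  calc ∫⁻ y, ‖∫ p, T (y - p) ∂μ‖ₑ ^ 2 ≤ ∫⁻ y, ∫⁻ p, ‖T (y - p)‖ₑ ^ 2 ∂μ := by
        refine lintegral_mono_ae ?_
        filter_upwards [hslice] with y hy
        rw [← eLpNorm_two_sq]
        refine pow_le_pow_left' ((enorm_integral_le_lintegral_enorm _).trans ?_) 2
        rw [← eLpNorm_one_eq_lintegral_enorm]
        exact eLpNorm_le_eLpNorm_of_exponent_le one_le_two hy
    _ = ∫⁻ p, ∫⁻ y, ‖T (y - p)‖ₑ ^ 2 ∂volume ∂μ :=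
        (lintegral_lintegral_swap (f := fun p y => ‖T (y - p)‖ₑ ^ 2)
          (hm.enorm.pow_const 2)).symm
    _ = ∫⁻ _p, eLpNorm T 2 volume ^ 2 ∂μ := by
        refine lintegral_congr fun p => ?_
        rw [← eLpNorm_two_sq]
        congr 1
        exact eLpNorm_comp_measurePreserving hT.1 (measurePreserving_sub_right volume p)
    _ < ∞ := by
        rw [lintegral_const, measure_univ, mul_one]
        exact ENNReal.pow_lt_top hT.2

theorem integral_translateLp {T : ℝ × ℝ → ℝ} (hT : MemLp T 2 volume) (hμ : μ ≪ volume) :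
    ∫ p, translateLp hT p ∂μ = (memLp_convolution hT hμ).toLp := by
  have hi : Integrable (translateLp hT) μ :=
    .of_bound (continuous_translateLp hT).aestronglyMeasurable ‖hT.toLp‖
      (.of_forall fun p => (norm_translateLp hT p).le)
  refine ext_inner_left ℝ fun φ => ?_
  have hφ := Lp.memLp φ
  have hinner : ∀ (g : ℝ × ℝ → ℝ) (hg : MemLp g 2 volume),
      inner ℝ φ hg.toLp = ∫ y, φ y * g y := by
    intro g hg
    rw [L2.inner_def]
    refine integral_congr_ae ?_
    filter_upwards [hg.coeFn_toLp] with y hy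
    rw [hy, RCLike.inner_apply]
    simp [mul_comm]
  have hint : Integrable (Function.uncurry fun p y : ℝ × ℝ => φ y * T (y - p))
      (μ.prod volume) := by
    have hm : AEStronglyMeasurable (Function.uncurry fun p y : ℝ × ℝ => φ y * T (y - p))
        (μ.prod volume) := hφ.1.comp_snd.mul (aestronglyMeasurable_translate hT hμ)
    rw [integrable_prod_iff hm]
    refine ⟨.of_forall fun p => hφ.integrable_mul (memLp_translate hT p), ?_⟩
    refine .of_bound hm.norm.integral_prod_right' (‖φ‖ * ‖hT.toLp‖) (.of_forall fun p => ?_)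
    have habs : ∫ y, ‖φ y * T (y - p)‖ = ∫ y, |φ y| * |T (y - p)| := by
      simp only [norm_mul, Real.norm_eq_abs]
    have h2 : ∫ y, |φ y| * |T (y - p)| =
        inner ℝ hφ.abs.toLp (memLp_translate hT p).abs.toLp := by
      rw [L2.inner_def]
      refine integral_congr_ae ?_
      filter_upwards [hφ.abs.coeFn_toLp, (memLp_translate hT p).abs.coeFn_toLp] with y h1 h2
      rw [h1, h2, RCLike.inner_apply]
      simp [mul_comm]
    have h3 : ‖hφ.abs.toLp‖ = ‖φ‖ := by
      rw [Lp.norm_toLp, Lp.norm_def]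
      exact congrArg _ (eLpNorm_norm φ)
    have h4 : ‖(memLp_translate hT p).abs.toLp‖ = ‖hT.toLp‖ := by
      rw [← norm_translateLp hT p, translateLp, Lp.norm_toLp, Lp.norm_toLp]
      exact congrArg _ (eLpNorm_norm fun y => T (y - p))
    show ‖∫ y, ‖φ y * T (y - p)‖‖ ≤ _
    rw [habs, h2, ← h3, ← h4]
    exact norm_inner_le_norm _ _
  rw [← integral_inner hi, hinner]
  calc ∫ p, inner ℝ φ (translateLp hT p) ∂μ = ∫ p, ∫ y, φ y * T (y - p) ∂volume ∂μ :=
        integral_congr_ae (.of_forall fun p => hinner _ (memLp_translate hT p))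
    _ = ∫ y, ∫ p, φ y * T (y - p) ∂μ := integral_integral_swap hint
    _ = ∫ y, φ y * ∫ p, T (y - p) ∂μ := by simp only [integral_const_mul]

end Translation

section RescaledKernel

variable {K : ℝ → ℝ} {h : ℝ}

theorem quasiMeasurePreserving_mul_right {a : ℝ} (ha : a ≠ 0) :
    Measure.QuasiMeasurePreserving (fun t : ℝ => t * a) volume volume := by
  refine ⟨measurable_mul_const a, ?_⟩
  rw [Real.map_volume_mul_right ha]
  exact Measure.smul_absolutelyContinuous

theorem memLp_scaled (hK : MemLp K 2 volume) (hh : 0 < h) : MemLp (scaled K h) 2 volume := by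
  have hm : AEStronglyMeasurable (fun t => K (t / h)) volume :=
    hK.1.comp_quasiMeasurePreserving (quasiMeasurePreserving_mul_right (inv_ne_zero hh.ne'))
  refine MemLp.const_mul ?_ (1 / h)
  rw [memLp_two_iff_integrable_sq hm]
  exact ((memLp_two_iff_integrable_sq hK.1).1 hK).comp_div hh.ne'

theorem scaled_ae_ne_zero (hK0 : ¬ K =ᵐ[volume] 0) (hh : 0 < h) :
    ¬ scaled K h =ᵐ[volume] 0 := by
  intro hs
  refine hK0 ?_
  have := (quasiMeasurePreserving_mul_right hh.ne').ae_eq_comp hs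
  filter_upwards [this] with t ht
  simp only [Function.comp_apply, scaled, Pi.zero_apply, mul_div_cancel_right₀ _ hh.ne',
    mul_eq_zero, one_div, inv_eq_zero, hh.ne', false_or] at ht
  exact ht

theorem tensor_ae_ne_zero {k : ℝ → ℝ} (hk0 : ¬ k =ᵐ[volume] 0) :
    ¬ (fun y : ℝ × ℝ => k y.1 * k y.2) =ᵐ[volume] 0 := by
  intro h
  have hprod : ∀ᵐ a : ℝ, ∀ᵐ b : ℝ, k a * k b = 0 := Measure.ae_ae_of_ae_prod h
  refine hk0 ?_
  by_contra hne
  have hfreq : ∃ᶠ a in ae (volume : Measure ℝ), ¬ k a = 0 := Filter.not_eventually.1 hne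
  obtain ⟨a, ha, hab⟩ := (hfreq.and_eventually hprod).exists
  refine hne ?_
  filter_upwards [hab] with b hb
  exact (mul_eq_zero.1 hb).resolve_left ha

end RescaledKernel

/-! ### The estimator as a mean of translates in `L²(ℝ²)` -/

section Reduction

variable {K : ℝ → ℝ} {h : ℝ} {f : ℝ × ℝ → ℝ}

/-- The kernel `(y₁, y₂) ↦ K_h(y₁) K_h(y₂)`, whose translates are the kernels of the summands
of the estimator. -/
noncomputable def productKernel (K : ℝ → ℝ) (h : ℝ) (y : ℝ × ℝ) : ℝ :=
  scaled K h y.1 * scaled K h y.2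

theorem memLp_productKernel (hk : MemLp (scaled K h) 2 volume) :
    MemLp (productKernel K h) 2 volume := memLp_tensor hk hk

theorem memLp_scaled_reflect (hk : MemLp (scaled K h) 2 volume) (a : ℝ) :
    MemLp (fun y => scaled K h (a - y)) 2 volume :=
  hk.comp_measurePreserving (Measure.measurePreserving_sub_left volume a)

theorem opTx_eq_integralOp (hk : MemLp (scaled K h) 2 volume) (x : ℝ × ℝ) :
    opTx K h x = integralOp fun y => productKernel K h (x - y) :=
  rankOne_toL2_eq_integralOp (memLp_scaled_reflect hk x.1) (memLp_scaled_reflect hk x.2)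

theorem smoothed_eq_convolution (hfm : Measurable f) (hf0 : ∀ x, 0 ≤ f x) :
    smoothed K h f = fun y => ∫ p, productKernel K h (y - p) ∂(law f) := by
  funext y
  rw [law, integral_withDensity_eq_integral_toReal_smul (by fun_prop)
    (.of_forall fun x => ENNReal.ofReal_lt_top)]
  refine integral_congr_ae (.of_forall fun p => ?_)
  simp only [ENNReal.toReal_ofReal (hf0 p), smul_eq_mul, productKernel, Prod.fst_sub,
    Prod.snd_sub, mul_assoc]

theorem law_absolutelyContinuous : law f ≪ volume := withDensity_absolutelyContinuous _ _

instance nullSingletonClass_law : NullSingletonClass (law f) := by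
  unfold law
  infer_instance

theorem fHat_eq {N : ℕ} (s : Fin N → ℝ × ℝ) :
    fHat K h s = (N : ℝ)⁻¹ • ∑ i, fun x => productKernel K h (x - s i) := by
  funext x
  simp [fHat, productKernel]

theorem memLp_fHat (hT : MemLp (productKernel K h) 2 volume) {N : ℕ} (s : Fin N → ℝ × ℝ) :
    MemLp (fHat K h s) 2 volume := by
  rw [fHat_eq]
  exact (memLp_finsetSum' _ fun i _ => memLp_translate hT (s i)).const_smul _

theorem toLp_fHat (hT : MemLp (productKernel K h) 2 volume) {N : ℕ} (s : Fin N → ℝ × ℝ) :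
    (memLp_fHat hT s).toLp = (N : ℝ)⁻¹ • ∑ i, translateLp hT (s i) := by
  refine Lp.ext ?_
  have hsum : ((∑ i, translateLp hT (s i) : L2Plane) : ℝ × ℝ → ℝ)
      =ᵐ[volume] ∑ i, (translateLp hT (s i) : ℝ × ℝ → ℝ) := Lp.coeFn_finsetSum _ _
  have hall : ∀ᵐ y : ℝ × ℝ, ∀ i, translateLp hT (s i) y = productKernel K h (y - s i) :=
    ae_all_iff.2 fun i => (memLp_translate hT (s i)).coeFn_toLp
  filter_upwards [(memLp_fHat hT s).coeFn_toLp,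
    Lp.coeFn_smul (N : ℝ)⁻¹ (∑ i, translateLp hT (s i)), hsum, hall] with y h1 h2 h3 h4
  rw [h1, h2, Pi.smul_apply, h3, fHat_eq]
  simp [h4]

theorem hsNorm_opTx_sub_opTx (hk : MemLp (scaled K h) 2 volume) (x x' : ℝ × ℝ) :
    hsNorm (opTx K h x - opTx K h x') =
      ‖translateLp (memLp_productKernel hk) x - translateLp (memLp_productKernel hk) x'‖ := by
  rw [opTx_eq_integralOp hk, opTx_eq_integralOp hk,
    hsNorm_integralOp_sub (memLp_reflect (memLp_productKernel hk) x)
      (memLp_reflect (memLp_productKernel hk) x'), norm_reflect_sub]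

theorem memLp_smoothed (hT : MemLp (productKernel K h) 2 volume) (hfm : Measurable f)
    (hf0 : ∀ x, 0 ≤ f x) [IsProbabilityMeasure (law f)] : MemLp (smoothed K h f) 2 volume := by
  rw [smoothed_eq_convolution hfm hf0]
  exact memLp_convolution hT law_absolutelyContinuous

theorem hsNorm_opTHat_sub_opT (hT : MemLp (productKernel K h) 2 volume) (hfm : Measurable f)
    (hf0 : ∀ x, 0 ≤ f x) [IsProbabilityMeasure (law f)] {N : ℕ} (s : Fin N → ℝ × ℝ) :
    hsNorm (opTHat K h s - opT K h f) =
      ‖(N : ℝ)⁻¹ • ∑ i, translateLp hT (s i) - ∫ p, translateLp hT p ∂(law f)‖ := by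
  rw [opTHat, opT, hsNorm_integralOp_sub (memLp_fHat hT s) (memLp_smoothed hT hfm hf0), toLp_fHat hT,
    integral_translateLp hT law_absolutelyContinuous]
  congr 2
  exact MemLp.toLp_congr _ _ (.of_forall fun y => by rw [smoothed_eq_convolution hfm hf0])

theorem continuous_reflectLp {T : ℝ × ℝ → ℝ} (hT : MemLp T 2 volume) :
    Continuous fun x => (memLp_reflect hT x).toLp := by
  have heq : (fun x => (memLp_reflect hT x).toLp) = translateLp (memLp_reflect hT 0) :=
    funext fun x => MemLp.toLp_congr _ _ (.of_forall fun y => by simp)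
  rw [heq]
  exact continuous_translateLp _

theorem hsNorm_opTx_sub_opT (hk : MemLp (scaled K h) 2 volume) (hfm : Measurable f)
    (hf0 : ∀ x, 0 ≤ f x) [IsProbabilityMeasure (law f)] (x : ℝ × ℝ) :
    hsNorm (opTx K h x - opT K h f) =
      ‖(memLp_reflect (memLp_productKernel hk) x).toLp -
        (memLp_smoothed (memLp_productKernel hk) hfm hf0).toLp‖ := by
  rw [opTx_eq_integralOp hk, opT,
    hsNorm_integralOp_sub (memLp_reflect (memLp_productKernel hk) x)
      (memLp_smoothed (memLp_productKernel hk) hfm hf0)]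

theorem bddAbove_hsNorm_opTx_sub (hk : MemLp (scaled K h) 2 volume) :
    BddAbove (Set.range fun q : (ℝ × ℝ) × (ℝ × ℝ) =>
      hsNorm (opTx K h q.1 - opTx K h q.2)) := by
  refine ⟨2 * ‖(memLp_productKernel hk).toLp‖, ?_⟩
  rintro _ ⟨q, rfl⟩
  simp only [hsNorm_opTx_sub_opTx hk]
  exact norm_translateLp_sub_le _ _ _

theorem norm_translateLp_sub_le_supL (hk : MemLp (scaled K h) 2 volume) (x x' : ℝ × ℝ) :
    ‖translateLp (memLp_productKernel hk) x - translateLp (memLp_productKernel hk) x'‖ ≤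
      supL K h := by
  rw [← hsNorm_opTx_sub_opTx hk]
  exact le_ciSup (bddAbove_hsNorm_opTx_sub hk) (x, x')

theorem supL_pos (hk : MemLp (scaled K h) 2 volume) (hk0 : ¬ scaled K h =ᵐ[volume] 0) :
    0 < supL K h := by
  refine lt_of_lt_of_le ?_ (norm_translateLp_sub_le_supL hk 0 (1, 0))
  rw [norm_pos_iff, sub_ne_zero]
  exact (injective_translateLp _ (tensor_ae_ne_zero hk0)).ne (by simp [Prod.ext_iff])

theorem integrable_hsNorm_opTx_sub_opT_sq (hk : MemLp (scaled K h) 2 volume)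
    (hfm : Measurable f) (hf0 : ∀ x, 0 ≤ f x) [IsProbabilityMeasure (law f)] :
    Integrable (fun x => hsNorm (opTx K h x - opT K h f) ^ 2) (law f) := by
  borelize L2Plane
  simp only [hsNorm_opTx_sub_opT hk hfm hf0]
  exact integrable_norm_sub_sq (continuous_reflectLp (memLp_productKernel hk)).measurable
    (L := supL K h)
    (fun x y => by rw [norm_reflect_sub]; exact norm_translateLp_sub_le_supL hk x y) _

/-- The kernel of `T_{h,x}` is a reflected translate of the product kernel, so that `T_h` is the
mean of `T_{h,X}` only for an even kernel `K`. In general `σ_h²` dominates the variance of the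
summands of the estimator: both families have the same pairwise distances, hence the same
variance, and the mean square distance to any fixed point is at least the variance. -/
theorem variance_le_sigmaSq (hk : MemLp (scaled K h) 2 volume) (hfm : Measurable f)
    (hf0 : ∀ x, 0 ≤ f x) [IsProbabilityMeasure (law f)] :
    ∫ x, ‖translateLp (memLp_productKernel hk) x -
      ∫ y, translateLp (memLp_productKernel hk) y ∂(law f)‖ ^ 2 ∂(law f) ≤ sigmaSq K h f := by
  borelize L2Plane
  have hT := memLp_productKernel hk
  have hd := norm_translateLp_sub_le_supL hk
  have hd' : ∀ x y, ‖(memLp_reflect hT x).toLp - (memLp_reflect hT y).toLp‖ ≤ supL K h :=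
    fun x y => by rw [norm_reflect_sub]; exact hd x y
  have h1 := integral_prod_norm_sub_sq (μ := law f)
    (continuous_translateLp (memLp_productKernel hk)).measurable hd
  have h2 := integral_prod_norm_sub_sq (μ := law f) (continuous_reflectLp hT).measurable hd'
  simp only [norm_reflect_sub hT] at h2
  have h3 := integral_norm_sub_sq (μ := law f) (continuous_reflectLp hT).measurable hd'
    (memLp_smoothed hT hfm hf0).toLp
  have h4 : sigmaSq K h f = ∫ x, ‖(memLp_reflect hT x).toLp -
      (memLp_smoothed hT hfm hf0).toLp‖ ^ 2 ∂(law f) := by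
    simp only [sigmaSq, hsNorm_opTx_sub_opT hk hfm hf0]
  rw [h4, h3]
  have h5 := sq_nonneg ‖∫ y, (memLp_reflect hT y).toLp ∂(law f) -
    (memLp_smoothed hT hfm hf0).toLp‖
  linarith

theorem uStat_eq (hk : MemLp (scaled K h) 2 volume) {N : ℕ} (s : Fin N → ℝ × ℝ) :
    uStat K h s = 1 / ((N : ℝ) * ((N : ℝ) - 1)) *
      ∑ p ∈ (Finset.univ : Finset (Fin N)).offDiag,
        ‖translateLp (memLp_productKernel hk) (s p.1) -
          translateLp (memLp_productKernel hk) (s p.2)‖ ^ 2 := by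
  simp only [uStat, hsNorm_opTx_sub_opTx hk]

end Reduction

theorem one_sub_measureReal_lt {Ω : Type*} [MeasurableSpace Ω] {P : Measure Ω}
    [IsProbabilityMeasure P] {D τ : Ω → ℝ} (hD : Measurable D) (hτ : Measurable τ) :
    P.real {ω | D ω ≤ τ ω} = 1 - P.real {ω | τ ω < D ω} := by
  rw [← probReal_compl_eq_one_sub (measurableSet_lt hτ hD)]
  congr 1
  ext ω
  simp

end MixtureRank

open MixtureRank in
theorem proposition7
    -- the kernel and the bandwidth
    (K : ℝ → ℝ) (hK1 : MemLp K 1 volume) (hK2 : MemLp K 2 volume)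
    (hK0 : ¬ K =ᵐ[volume] 0) (h : ℝ) (hh : 0 < h)
    -- the square integrable density of the observations
    (f : ℝ × ℝ → ℝ) (hfm : Measurable f) (hf0 : ∀ x, 0 ≤ f x) (hf2 : MemLp f 2 volume)
    -- the i.i.d. sample
    {Ω : Type*} [MeasurableSpace Ω] (P : Measure Ω) [IsProbabilityMeasure P]
    (N : ℕ) (hN : 2 ≤ N) (X : Fin N → Ω → ℝ × ℝ) (hXm : ∀ i, Measurable (X i))
    (hXi : iIndepFun X P) (hXl : ∀ i, P.map (X i) = MixtureRank.law f) :
    -- all the quantities involved are well defined, and the denominators do not vanish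
    ((∀ x : ℝ × ℝ, Integrable (fun p : ℝ × ℝ => f p * MixtureRank.scaled K h (x.1 - p.1) *
          MixtureRank.scaled K h (x.2 - p.2)) volume) ∧
      MemLp (MixtureRank.smoothed K h f) 2 volume ∧
      (∀ s : Fin N → ℝ × ℝ, MemLp (MixtureRank.fHat K h s) 2 volume) ∧
      (∀ a : ℝ, MemLp (fun y => MixtureRank.scaled K h (a - y)) 2 volume) ∧
      MixtureRank.IsHilbertSchmidt (MixtureRank.opT K h f) ∧
      (∀ s : Fin N → ℝ × ℝ, MixtureRank.IsHilbertSchmidt (MixtureRank.opTHat K h s)) ∧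
      (∀ x, MixtureRank.IsHilbertSchmidt (MixtureRank.opTx K h x)) ∧
      BddAbove (Set.range fun q : (ℝ × ℝ) × (ℝ × ℝ) =>
        MixtureRank.hsNorm (MixtureRank.opTx K h q.1 - MixtureRank.opTx K h q.2)) ∧
      Integrable (fun x => MixtureRank.hsNorm (MixtureRank.opTx K h x - MixtureRank.opT K h f) ^ 2)
        (MixtureRank.law f) ∧
      AEMeasurable (fun ω => MixtureRank.hsNorm
        (MixtureRank.opTHat K h (fun i => X i ω) - MixtureRank.opT K h f)) P ∧
      AEMeasurable (fun ω => MixtureRank.uStat K h (fun i => X i ω)) P ∧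
      0 < MixtureRank.supL K h ∧ 0 < MixtureRank.sigmaSq K h f) ∧
    -- the exponential tail bound
    (∀ τ : ℝ, 0 < τ →
      P.real {ω | τ < MixtureRank.hsNorm
          (MixtureRank.opTHat K h (fun i => X i ω) - MixtureRank.opT K h f)} ≤
        MixtureRank.tailBound N (MixtureRank.supL K h) (MixtureRank.sigmaSq K h f) τ) ∧
    -- the bound at confidence level `1 - δ`
    (∀ δ : ℝ, 0 < δ → δ < 1 →
      (∃ τ : ℝ, 0 < τ ∧
        MixtureRank.tailBound N (MixtureRank.supL K h) (MixtureRank.sigmaSq K h f) τ = δ) ∧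
      ∀ τ : ℝ, 0 < τ →
        MixtureRank.tailBound N (MixtureRank.supL K h) (MixtureRank.sigmaSq K h f) τ = δ →
        1 - δ ≤ P.real {ω | MixtureRank.hsNorm
          (MixtureRank.opTHat K h (fun i => X i ω) - MixtureRank.opT K h f) ≤ τ}) ∧
    -- the data-driven bound
    (∀ δ : ℝ, 0 < δ → δ < 1 / 2 →
      1 - 2 * δ < P.real {ω | MixtureRank.hsNorm
        (MixtureRank.opTHat K h (fun i => X i ω) - MixtureRank.opT K h f) ≤
          MixtureRank.tauHat K h δ (fun i => X i ω)}) := by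
  have hk : MemLp (scaled K h) 2 volume := memLp_scaled hK2 hh
  have hk0 : ¬ scaled K h =ᵐ[volume] 0 := scaled_ae_ne_zero hK0 hh
  have hT : MemLp (productKernel K h) 2 volume := memLp_productKernel hk
  have hprob : IsProbabilityMeasure (law f) := by
    rw [← hXl ⟨0, by omega⟩]
    exact Measure.isProbabilityMeasure_map (hXm _).aemeasurable
  borelize L2Plane
  have hψ : Measurable (translateLp hT) := (continuous_translateLp hT).measurable
  have hd : ∀ x y, ‖translateLp hT x - translateLp hT y‖ ≤ supL K h :=
    norm_translateLp_sub_le_supL hk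
  have hL : 0 < supL K h := supL_pos hk hk0
  have hv : 0 < ∫ x, ‖translateLp hT x - ∫ y, translateLp hT y ∂(law f)‖ ^ 2 ∂(law f) :=
    variance_pos hψ hd (injective_translateLp hT (tensor_ae_ne_zero hk0))
  have hvσ := variance_le_sigmaSq hk hfm hf0
  have hσ : 0 < sigmaSq K h f := hv.trans_le hvσ
  have hD : Measurable fun ω => hsNorm (opTHat K h (fun i => X i ω) - opT K h f) := by
    simp only [hsNorm_opTHat_sub_opT hT hfm hf0]
    fun_prop
  have hU : Measurable fun ω => uStat K h (fun i => X i ω) := by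
    simp only [uStat_eq hk]
    fun_prop
  have htail : ∀ τ : ℝ, 0 < τ →
      P.real {ω | τ < hsNorm (opTHat K h (fun i => X i ω) - opT K h f)} ≤
        tailBound N (supL K h) (sigmaSq K h f) τ := by
    intro τ hτ
    rw [← chernoff_eq_tailBound N hL hσ hτ]
    simp only [hsNorm_opTHat_sub_opT hT hfm hf0]
    refine measure_lt_norm_average_le hψ hd hL (by omega) hXm hXi hXl hvσ
      (mul_nonneg (by positivity) (Real.log_nonneg ?_)) hτ.le
    have : 0 ≤ τ * supL K h / sigmaSq K h f := by positivity
    linarith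
  refine ⟨⟨fun x => ?_, memLp_smoothed hT hfm hf0, memLp_fHat hT, memLp_scaled_reflect hk,
    isHilbertSchmidt_integralOp (memLp_smoothed hT hfm hf0),
    fun s => isHilbertSchmidt_integralOp (memLp_fHat hT s), fun x => ?_,
    bddAbove_hsNorm_opTx_sub hk, integrable_hsNorm_opTx_sub_opT_sq hk hfm hf0, hD.aemeasurable,
    hU.aemeasurable, hL, hσ⟩, htail, fun δ hδ0 hδ1 => ⟨?_, fun τ hτ hτδ => ?_⟩,
    fun δ hδ0 hδ => ?_⟩
  · simp only [mul_assoc]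
    exact hf2.integrable_mul (memLp_reflect hT x)
  · rw [opTx_eq_integralOp hk]
    exact isHilbertSchmidt_integralOp (memLp_reflect hT x)
  · exact exists_tailBound_eq (by omega) hL hσ hδ0 (by linarith)
  · rw [one_sub_measureReal_lt hD measurable_const]
    have := htail τ hτ
    linarith
  · have hτ : Measurable fun ω => tauHat K h δ (fun i => X i ω) := by
      unfold tauHat
      fun_prop
    rw [one_sub_measureReal_lt hD hτ]
    have := measure_empirical_bernstein_lt (P := P) hψ hd hL hN hXm hXi hXl hv hδ0 hδ
    simp only [tauHat, uStat_eq hk, hsNorm_opTHat_sub_opT hT hfm hf0]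
    linarith
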